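/- Let $\mathbb{D}=\{z\in\mathbb{C}:|z|<1\}$. For $1\le p<\infty$ and $\beta>-1$, let $H^p$ be the Hardy space of $\mathbb{D}$, with norm $$\|f\|_{H^p}=\sup_{0\le\rho<1}\Big(\frac1{2\pi}\int_0^{2\pi}|f(\rho e^{i\theta})|^p\,d\theta\Big)^{1/p},$$ let $A^p(\beta)$ be the space of the holomorphic functions $f$ on $\mathbb{D}$ with $$\|f\|_{A^p(\beta)}=\Big(\int_{\mathbb{D}}|f(z)|^p(1-|z|^2)^\beta\,d\mathcal{A}(z)\Big)^{1/p}<\infty,$$ where $\mathcal{A}$ is the area measure normalized by $\mathcal{A}(\mathbb{D})=1$, and let $H^\infty$ be the space of bounded holomorphic functions on $\mathbb{D}$ with the supremum norm. For $X=H^p$ or $X=A^p(\beta)$ and a finite sequence $\sigma=(\lambda_1,\dots,\lambda_n)\in\mathbb{D}^n$ put $$c(\sigma,X,H^\infty)=\sup_{f\in X,\ \|f\|_X\le1}\ \inf\{\|g\|_\infty:\ g\in H^\infty,\ g|_\sigma=f|_\sigma\},$$ where $g|_\sigma=f|_\sigma$ means that $f-g$ vanishes at each point $\lambda$ of $\sigma$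 to order at least the multiplicity of $\lambda$ in $\sigma$. For $n\ge1$ and $r\in[0,1)$ put $$C_{n,r}(X,H^\infty)=\sup\{c(\sigma,X,H^\infty):\ \sigma\in\mathbb{D}^n,\ \max_i|\lambda_i|\le r\}.$$ For $\lambda\in\mathbb{D}$ let $\sigma_{n,\lambda}=(\lambda,\dots,\lambda)\in\mathbb{D}^n$, and for $t\in[0,1)$ let $\varphi_X(t)=\sup\{|f(t)|:f\in X,\ \|f\|_X\le1\}$ be the norm of the evaluation functional at $t$. **Theorem.** (1) For every $p\in[1,\infty)$ there are constants $a,b>0$ depending only on $p$ such that, for all $n\ge1$, $r\in[0,1)$, $$a\Big(\frac{n}{1-r}\Big)^{1/p}\le C_{n,r}(H^p,H^\infty)\le b\Big(\frac{n}{1-r}\Big)^{1/p},$$ and, for every $\lambda$ with $|\lambda|=r$, $$c(\sigma_{n,\lambda},H^p,H^\infty)\ge a\Big(\frac{n}{1-r}\Big)^{1/p}.$$ (2) For every $p\in[1,\infty)$ and $\beta>-1$ there are constants $a,b>0$ depending only on $p$ and $\beta$ such that, for all $n\ge1$, $r\in[0,1)$, $$a\Big(\frac{n}{1-r}\Big)^{(2+\beta)/p}\le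 C_{n,r}(A^p(\beta),H^\infty)\le b\Big(\frac{n}{1-r}\Big)^{(2+\beta)/p},$$ for every $\lambda$ with $|\lambda|=r$, $$c(\sigma_{n,\lambda},A^p(\beta),H^\infty)\ge a\Big(\frac{n}{1-r}\Big)^{(2+\beta)/p},$$ and $$a\,\varphi_{A^p(\beta)}\Big(1-\frac{1-r}{n}\Big)\le C_{n,r}(A^p(\beta),H^\infty)\le b\,\varphi_{A^p(\beta)}\Big(1-\frac{1-r}{n}\Big).$$ -/

import Mathlib

open scoped ENNReal

noncomputable section

namespace DiscInterp

/-- The open unit disc in the complex plane. -/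
abbrev disc : Set ℂ := Metric.ball 0 1

/-- The integral mean `M_p(ρ, f)` of `|f|` over the circle of radius `ρ`, for the normalized
arc length. -/
def circleMean (p : ℝ) (f : ℂ → ℂ) (ρ : ℝ) : ℝ≥0∞ :=
  ((ENNReal.ofReal (2 * Real.pi))⁻¹ *
    ∫⁻ θ in Set.Ioc (0 : ℝ) (2 * Real.pi), ‖f (circleMap 0 ρ θ)‖ₑ ^ p) ^ (1 / p)

/-- The norm of the Hardy space `H^p`, with values in `[0, ∞]`. -/
def hardyNorm (p : ℝ) (f : ℂ → ℂ) : ℝ≥0∞ :=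
  ⨆ ρ ∈ Set.Ico (0 : ℝ) 1, circleMean p f ρ

/-- The norm of the weighted Bergman space `A^p(β)`, with values in `[0, ∞]`; the area measure on
the disc is normalized to have total mass one. -/
def bergmanNorm (p β : ℝ) (f : ℂ → ℂ) : ℝ≥0∞ :=
  ((ENNReal.ofReal Real.pi)⁻¹ *
    ∫⁻ z in disc, ‖f z‖ₑ ^ p * ENNReal.ofReal ((1 - ‖z‖ ^ 2) ^ β)) ^ (1 / p)

/-- The supremum norm over the disc, with values in `[0, ∞]`. -/
def supNorm (f : ℂ → ℂ) : ℝ≥0∞ := ⨆ z ∈ disc, ‖f z‖ₑ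

/-- The space `H^∞` of bounded holomorphic functions on the disc. -/
def hInfty : Set (ℂ → ℂ) := {g | DifferentiableOn ℂ g disc ∧ supNorm g < ⊤}

/-- For an extended norm `N`, the closed unit ball of the space of the functions that are
holomorphic on the disc and have finite `N`-norm. -/
def unitBall (N : (ℂ → ℂ) → ℝ≥0∞) : Set (ℂ → ℂ) :=
  {f | DifferentiableOn ℂ f disc ∧ N f ≤ 1}

/-- `f` and `g` have the same trace on the finite sequence `σ`: at every point, `f - g` vanishes
at least to the order with which this point occurs in `σ`. -/
def SameTrace {n : ℕ} (σ : Fin n → ℂ) (f g : ℂ → ℂ) : Prop :=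
  ∀ z : ℂ, ((Finset.univ.filter fun i => σ i = z).card : ℕ∞) ≤
    analyticOrderAt (fun w => f w - g w) z

/-- The interpolation quantity `c(σ, X, H^∞)`, where `X` is given by its extended norm `N`. -/
def interpConst (N : (ℂ → ℂ) → ℝ≥0∞) {n : ℕ} (σ : Fin n → ℂ) : ℝ≥0∞ :=
  ⨆ f ∈ unitBall N, ⨅ g ∈ {g | g ∈ hInfty ∧ SameTrace σ f g}, supNorm g

/-- The worst-case constant `C_{n,r}(X, H^∞)`. -/
def worstInterpConst (N : (ℂ → ℂ) → ℝ≥0∞) (n : ℕ) (r : ℝ) : ℝ≥0∞ :=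
  ⨆ σ ∈ {σ : Fin n → ℂ | ∀ i, σ i ∈ disc ∧ ‖σ i‖ ≤ r}, interpConst N σ

/-- The norm of the evaluation functional `f ↦ f t` on the space with extended norm `N`. -/
def evalNorm (N : (ℂ → ℂ) → ℝ≥0∞) (t : ℂ) : ℝ≥0∞ := ⨆ f ∈ unitBall N, ‖f t‖ₑ

end DiscInterp

end

open scoped ENNReal

noncomputable section

namespace DiscInterp

open ComplexConjugate MeasureTheory

/-! Both spaces enter through only two facts, with `s = 1 / p` for Hardy and `s = (2 + β) / p` for
Bergman: evaluation at `w` is bounded by `C (1 - |w|) ^ (-s)`, and suitably normalized powers of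
Cauchy kernels lie in the unit ball and attain this growth. `interpConst_estimates` derives
everything from these facts.

Upper bound. Let `B` be the Blaschke product of `σ`. On the circle of radius `ρ = 1 - (1 - r) / (8
n)` one has `|B| ≥ 1/2`, while `|f| ≤ M`, where `M` is of order `(n / (1 - r)) ^ s`. Write `f = T +
B h`, with `T` in the model space of `B`, so that `z T / B` is an antiholomorphic function `conj S`
of the reflected point `ρ ^ 2 / conj z`. Then `g = T + ρ ^ 2 B(z) h(ρ ^ 2 z)` has the trace of `f`,
and for `|z| = 1` the modulus of `g` is that of the harmonic function `conj (S v) + v h v` at `v = ρ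
^ 2 z`. On `|v| = ρ`, where reflection is the identity, that function equals `v f v / B v`, hence is
at most `2 M`. The maximum principle gives `|g| ≤ 2 M` (`exists_bounded_interpolant`).

Lower bound. Suppose that all `n` nodes equal `a`. A Cauchy kernel power `f` with pole at distance
about `(1 - |a|) / n` from the circle has supremum at most `M`, again of order `(n / (1 - |a|)) ^
s`, and still has size `3 M / 4` at a point `X` with `1 - |X| = (1 - |a|) / n`. If `g` has the same
trace, the Schwarz lemma makes `f - g` at most half of `M + sup |g|` at `X`, because the Blaschke
factor there is at most `1 - 1 / n`. Hence `sup |g| ≥ M / 6` (`le_interpConst_const`).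

The growth of evaluations comes from the Poisson formula and Jensen's inequality on circles; for
Bergman spaces it is then integrated over an annulus. The norms of the kernels are computed by
comparing them with the Poisson kernel. -/

/-! ### Blaschke products near the unit circle -/

/-- The finite Blaschke product with zeros `σ`. -/
def blaschke {n : ℕ} (σ : Fin n → ℂ) (z : ℂ) : ℂ :=
  ∏ i, (z - σ i) / (1 - conj (σ i) * z)

theorem one_sub_conj_mul_ne_zero {a z : ℂ} (ha : ‖a‖ < 1) (hz : ‖z‖ ≤ 1) :
    1 - conj a * z ≠ 0 := by
  intro h
  have h1 : ‖conj a * z‖ = 1 := by rw [← sub_eq_zero.mp h]; simp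
  rw [norm_mul, RCLike.norm_conj] at h1
  nlinarith [norm_nonneg a, norm_nonneg z]

theorem blaschke_succ {n : ℕ} (σ : Fin (n + 1) → ℂ) (z : ℂ) :
    blaschke σ z = blaschke (fun i : Fin n => σ i.castSucc) z *
      ((z - σ (Fin.last n)) / (1 - conj (σ (Fin.last n)) * z)) := by
  simp only [blaschke, Fin.prod_univ_castSucc]

theorem differentiableAt_blaschke {n : ℕ} {σ : Fin n → ℂ} (hσ : ∀ i, ‖σ i‖ < 1) {z : ℂ}
    (hz : ‖z‖ ≤ 1) : DifferentiableAt ℂ (blaschke σ) z := by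
  unfold blaschke
  refine DifferentiableAt.fun_finsetProd fun i _ => ?_
  have := one_sub_conj_mul_ne_zero (hσ i) hz
  fun_prop (disch := assumption)

/-- This identity controls the distance of a Blaschke factor's modulus from one, and shows that disc
automorphisms preserve the disc. -/
theorem norm_sq_one_sub_conj_mul_sub (a z : ℂ) :
    ‖1 - conj a * z‖ ^ 2 - ‖z - a‖ ^ 2 = (1 - ‖a‖ ^ 2) * (1 - ‖z‖ ^ 2) := by
  simp only [← Complex.normSq_eq_norm_sq, Complex.normSq_apply]
  simp
  ring

theorem norm_blaschke_factor_of_norm_eq_one {a z : ℂ} (ha : ‖a‖ < 1) (hz : ‖z‖ = 1) :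
    ‖(z - a) / (1 - conj a * z)‖ = 1 := by
  have h := norm_sq_one_sub_conj_mul_sub a z
  rw [hz] at h
  have h0 := norm_pos_iff.mpr (one_sub_conj_mul_ne_zero ha hz.le)
  rw [norm_div, div_eq_one_iff_eq h0.ne']
  nlinarith [norm_nonneg (z - a)]

theorem norm_blaschke_of_norm_eq_one {n : ℕ} {σ : Fin n → ℂ} (hσ : ∀ i, ‖σ i‖ < 1) {z : ℂ}
    (hz : ‖z‖ = 1) : ‖blaschke σ z‖ = 1 := by
  unfold blaschke
  rw [norm_prod]
  exact Finset.prod_eq_one fun i _ => norm_blaschke_factor_of_norm_eq_one (hσ i) hz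

/-- Away from its zero, a Blaschke factor is close to one in modulus. -/
theorem le_norm_blaschke_factor {a z : ℂ} {r ρ : ℝ} (ha : ‖a‖ ≤ r) (hr : r < 1)
    (hρ : ρ < 1) (hz : ‖z‖ = ρ) :
    1 - 4 * (1 - ρ) / (1 - r) ≤ ‖(z - a) / (1 - conj a * z)‖ := by
  have ha1 : ‖a‖ < 1 := ha.trans_lt hr
  have h0 := norm_pos_iff.mpr (one_sub_conj_mul_ne_zero ha1 (hz.le.trans hρ.le))
  have ha0 := norm_nonneg a
  have hρ0 : 0 ≤ ρ := hz ▸ norm_nonneg z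
  have hid := norm_sq_one_sub_conj_mul_sub a z
  have hD : 1 - ‖a‖ ≤ ‖1 - conj a * z‖ := by
    have := norm_sub_norm_le 1 (conj a * z)
    rw [norm_mul, RCLike.norm_conj, norm_one, hz] at this
    nlinarith
  rw [norm_div]
  rw [hz] at hid
  set D := ‖1 - conj a * z‖
  set E := ‖z - a‖
  have hE0 : 0 ≤ E := norm_nonneg _
  have hprod : (1 - ‖a‖ ^ 2) * (1 - ρ ^ 2) ≤ 4 * (1 - ρ) * (1 - ‖a‖) := by
    have h1 : (1 + ‖a‖) * (1 + ρ) ≤ 2 * 2 := by gcongr <;> linarith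
    have h2 : 0 ≤ (1 - ‖a‖) * (1 - ρ) := mul_nonneg (by linarith) (by linarith)
    nlinarith
  have hquot : 1 - E ^ 2 / D ^ 2 ≤ 4 * (1 - ρ) / (1 - r) := by
    have e : 1 - E ^ 2 / D ^ 2 = (1 - ‖a‖ ^ 2) * (1 - ρ ^ 2) / D ^ 2 := by
      rw [← hid]; field_simp
    rw [e]
    calc (1 - ‖a‖ ^ 2) * (1 - ρ ^ 2) / D ^ 2
        ≤ 4 * (1 - ρ) * (1 - ‖a‖) / (1 - ‖a‖) ^ 2 := by
          gcongr
      _ = 4 * (1 - ρ) / (1 - ‖a‖) := by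
          have : 1 - ‖a‖ ≠ 0 := by linarith
          field_simp
      _ ≤ _ := by
          gcongr
  have hED : E / D ≤ 1 := by
    rw [div_le_one h0]
    have : 0 ≤ (1 - ‖a‖ ^ 2) * (1 - ρ ^ 2) := by
      apply mul_nonneg <;> nlinarith
    exact (abs_le_of_sq_le_sq' (by linarith) h0.le).2
  -- The estimate `hquot` concerns the square of the modulus; it passes to the modulus because that
  -- is at most one.
  have : (E / D) ^ 2 ≤ E / D := by nlinarith [div_nonneg hE0 h0.le]
  rw [div_pow] at this
  linarith

/-- The constant `8` makes each factor at least `1 - 1 / (2 n)`, and Bernoulli's inequality bounds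
the product of `n` of them below by `1/2`. -/
theorem half_le_norm_blaschke {n : ℕ} (hn : 1 ≤ n) {σ : Fin n → ℂ} {r : ℝ}
    (hr : r < 1) (hσ : ∀ i, ‖σ i‖ ≤ r) {z : ℂ} (hz : ‖z‖ = 1 - (1 - r) / (8 * n)) :
    1 / 2 ≤ ‖blaschke σ z‖ := by
  have hn' : (1 : ℝ) ≤ n := by exact_mod_cast hn
  have h1r : 0 < 1 - r := by linarith
  have hpos : 0 < (1 - r) / (8 * n) := by positivity
  have hf : ∀ i, 1 - 1 / (2 * (n : ℝ)) ≤ ‖(z - σ i) / (1 - conj (σ i) * z)‖ := by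
    intro i
    refine le_trans (le_of_eq ?_) (le_norm_blaschke_factor (hσ i) hr (by linarith) hz)
    field_simp
    ring
  have hx : 1 / (2 * (n : ℝ)) ≤ 1 / 2 := by
    apply one_div_le_one_div_of_le <;> linarith
  have hB : 1 / 2 ≤ (1 - 1 / (2 * (n : ℝ))) ^ n := by
    have := one_add_mul_le_pow (a := -(1 / (2 * (n : ℝ)))) (by linarith) n
    have h2 : 1 + (n : ℝ) * -(1 / (2 * n)) = 1 / 2 := by field_simp; ring
    rw [h2] at this
    simpa [sub_eq_add_neg] using this
  unfold blaschke
  rw [norm_prod]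
  calc (1 / 2 : ℝ) ≤ (1 - 1 / (2 * (n : ℝ))) ^ n := hB
    _ = ∏ i : Fin n, (1 - 1 / (2 * (n : ℝ))) := by simp
    _ ≤ _ := Finset.prod_le_prod (fun i _ => by linarith) fun i _ => hf i

/-! ### A bounded interpolant by reflection -/

/-- Maximum principle for the harmonic function `conj S + K`. -/
theorem norm_conj_add_le_of_sphere {S K : ℂ → ℂ} {ρ M : ℝ} (hρ : 0 < ρ)
    (hS : ∀ w, ‖w‖ ≤ ρ → DifferentiableAt ℂ S w) (hK : ∀ w, ‖w‖ ≤ ρ → DifferentiableAt ℂ K w)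
    (hM : ∀ w, ‖w‖ = ρ → ‖conj (S w) + K w‖ ≤ M) {v : ℂ} (hv : ‖v‖ ≤ ρ) :
    ‖conj (S v) + K v‖ ≤ M := by
  set a := conj (S v) + K v with ha
  -- Rotating by `u` makes the value at `v` real. The real part of `u * conj S` is that of `conj u *
  -- S`, so the rotated function has the real part of a holomorphic function, and maximum modulus
  -- applies to its exponential.
  obtain ⟨u, hu1, hu⟩ : ∃ u : ℂ, ‖u‖ = 1 ∧ u * a = ‖a‖ := by
    rcases eq_or_ne a 0 with h | h
    · exact ⟨1, by simp, by simp [h]⟩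
    · refine ⟨‖a‖ / a, by simp [h], by field_simp⟩
  have hre : ∀ w, (conj u * S w + u * K w).re = (u * (conj (S w) + K w)).re := by
    intro w; simp; ring
  have hd : DiffContOnCl ℂ (fun w => Complex.exp (conj u * S w + u * K w)) (Metric.ball 0 ρ) := by
    apply DifferentiableOn.diffContOnCl
    rw [closure_ball _ hρ.ne']
    intro w hw
    have hw' : ‖w‖ ≤ ρ := by simpa using hw
    have := hS w hw'
    have := hK w hw'
    apply DifferentiableAt.differentiableWithinAt
    fun_prop
  have := Complex.norm_le_of_forall_mem_frontier_norm_le Metric.isBounded_ball hd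
    (C := Real.exp M) (fun w hw => by
      rw [frontier_ball _ hρ.ne'] at hw
      rw [Complex.norm_exp, hre]
      apply Real.exp_le_exp.mpr
      refine (Complex.re_le_norm _).trans ?_
      rw [norm_mul, hu1, one_mul]
      exact hM w (by simpa using hw)) (z := v) (by rw [closure_ball _ hρ.ne']; simpa using hv)
  rw [Complex.norm_exp, hre, ← ha, hu] at this
  simpa using this

/-- Splitting `f = T + B h`, where `B` is the Blaschke product of `σ` and `z T z / B z` continues
analytically to the exterior of the disc of radius `r`, including infinity. -/
theorem exists_blaschke_splitting {r ρ : ℝ} (hrρ : r < ρ) (hρ1 : ρ < 1) (hr0 : 0 ≤ r)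
    {f : ℂ → ℂ} (hf : DifferentiableOn ℂ f disc) {n : ℕ} (σ : Fin n → ℂ) (hσ : ∀ i, ‖σ i‖ ≤ r) :
    ∃ T h S : ℂ → ℂ, (∀ z, ‖z‖ ≤ 1 → DifferentiableAt ℂ T z) ∧ DifferentiableOn ℂ h disc ∧
      (∀ w, ‖w‖ ≤ ρ → DifferentiableAt ℂ S w) ∧ (∀ z ∈ disc, f z = T z + blaschke σ z * h z) ∧
      ∀ z, r < ‖z‖ → ‖z‖ ≤ 1 → z * T z = blaschke σ z * conj (S (ρ ^ 2 / conj z)) := by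
  induction n with
  | zero => exact ⟨0, f, 0, by simp, hf, by simp, by simp [blaschke], by simp⟩
  | succ n ih =>
    obtain ⟨T, h, S, hT, hh, hS, hfe, hTS⟩ := ih (fun i => σ i.castSucc) (fun i => hσ _)
    set a := σ (Fin.last n) with ha
    have har : ‖a‖ ≤ r := hσ _
    have ha1 : ‖a‖ < 1 := by linarith
    set B := blaschke (fun i : Fin n => σ i.castSucc) with hB
    -- Splitting off the constant `k a` writes `h` as `k a / (1 - conj a * z)` plus the new Blaschke
    -- factor times the difference quotient of `k`.
    set k : ℂ → ℂ := fun z => h z * (1 - conj a * z) with hk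
    have hkd : DifferentiableOn ℂ k disc := by
      rw [hk]; fun_prop
    have hρ0 : 0 < ρ := by linarith
    -- The pole created by the new factor lies at `ρ ^ 2 / conj a`, outside the closed disc of
    -- radius `ρ` since `|a| ≤ r < ρ`.
    have hS0 : ∀ w : ℂ, ‖w‖ ≤ ρ → (ρ : ℂ) ^ 2 - conj a * w ≠ 0 := by
      intro w hw h
      have h1 : ‖conj a * w‖ = ρ ^ 2 := by
        rw [← sub_eq_zero.mp h]; simp
      rw [norm_mul, RCLike.norm_conj] at h1
      nlinarith [norm_nonneg a, norm_nonneg w]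
    refine ⟨fun z => T z + B z * (k a / (1 - conj a * z)), dslope k a,
      fun w => S w * ((w - a * ρ ^ 2) / (ρ ^ 2 - conj a * w)) +
        conj (k a) * (ρ ^ 2 / (ρ ^ 2 - conj a * w)), ?_, ?_, ?_, ?_, ?_⟩
    · intro z hz
      have h1 := hT z hz
      have h2 : DifferentiableAt ℂ B z :=
        differentiableAt_blaschke (fun i => (hσ _).trans_lt (by linarith)) hz
      have h3 := one_sub_conj_mul_ne_zero ha1 hz
      fun_prop (disch := assumption)
    · exact (Complex.differentiableOn_dslope (Metric.isOpen_ball.mem_nhds (by simpa using ha1))).mpr hkd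
    · intro w hw
      have h1 := hS w hw
      have h3 := hS0 w hw
      fun_prop (disch := assumption)
    · intro z hz
      have hz1 : ‖z‖ < 1 := by simpa using hz
      have h3 := one_sub_conj_mul_ne_zero ha1 hz1.le
      have h4 : (z - a) * dslope k a z = k z - k a := by
        simpa using sub_smul_dslope k a z
      rw [hfe z hz, blaschke_succ, ← ha, ← hB]
      have h5 : h z = k z / (1 - conj a * z) := by rw [hk]; field_simp
      rw [h5, mul_assoc, div_mul_eq_mul_div, h4]
      ring
    · intro z hz hz1
      have h3 := one_sub_conj_mul_ne_zero ha1 hz1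
      have hza : z - a ≠ 0 := by
        intro h; rw [sub_eq_zero.mp h] at hz; linarith
      have hz0 : z ≠ 0 := by
        rintro rfl; simp at hz; linarith
      have hρc : (ρ : ℂ) ≠ 0 := by exact_mod_cast hρ0.ne'
      rw [blaschke_succ, ← ha, ← hB, mul_add, hTS z hz hz1]
      simp only [map_add, map_mul, map_div₀, map_sub, map_pow, Complex.conj_conj, Complex.conj_ofReal]
      -- With `w = ρ ^ 2 / conj z`, the conjugates of the two fractions in the new `S` are the
      -- inverse Blaschke factor and `z / (z - a)`.
      have e1 : ((ρ : ℂ) ^ 2 / z - conj a * ρ ^ 2) / (ρ ^ 2 - a * (ρ ^ 2 / z)) =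
          (1 - conj a * z) / (z - a) := by
        have : (ρ : ℂ) ^ 2 - a * (ρ ^ 2 / z) = ρ ^ 2 * (z - a) / z := by field_simp
        rw [this]
        field_simp
      have e2 : (ρ : ℂ) ^ 2 / (ρ ^ 2 - a * (ρ ^ 2 / z)) = z / (z - a) := by
        have : (ρ : ℂ) ^ 2 - a * (ρ ^ 2 / z) = ρ ^ 2 * (z - a) / z := by field_simp
        rw [this]
        field_simp
      rw [e1, e2]
      have h3' : 1 - z * conj a ≠ 0 := by rwa [mul_comm z]
      field_simp

/-- A holomorphic function bounded by `M` on a circle on which `|B| ≥ 1/2` agrees on `σ` with a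
function bounded by `2 M` on the whole disc. -/
theorem exists_bounded_interpolant {r ρ : ℝ} (hrρ : r < ρ) (hρ1 : ρ < 1) (hr0 : 0 ≤ r)
    {f : ℂ → ℂ} (hf : DifferentiableOn ℂ f disc) {n : ℕ} (σ : Fin n → ℂ) (hσ : ∀ i, ‖σ i‖ ≤ r)
    {M : ℝ} (hM : ∀ w, ‖w‖ = ρ → ‖f w‖ ≤ M) (hB : ∀ w, ‖w‖ = ρ → 1 / 2 ≤ ‖blaschke σ w‖) :
    ∃ g k : ℂ → ℂ, DifferentiableOn ℂ g disc ∧ DifferentiableOn ℂ k disc ∧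
      (∀ z ∈ disc, ‖g z‖ ≤ 2 * M) ∧ ∀ z ∈ disc, f z - g z = blaschke σ z * k z := by
  obtain ⟨T, h, S, hT, hh, hS, hfe, hTS⟩ := exists_blaschke_splitting hrρ hρ1 hr0 hf σ hσ
  have hρ0 : 0 < ρ := by linarith
  have hσ1 : ∀ i, ‖σ i‖ < 1 := fun i => (hσ i).trans_lt (by linarith)
  have hmaps : ∀ z : ℂ, ‖z‖ ≤ 1 → ‖(ρ : ℂ) ^ 2 * z‖ < 1 ∧ ‖(ρ : ℂ) ^ 2 * z‖ ≤ ρ := by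
    intro z hz
    rw [norm_mul, norm_pow, Complex.norm_real, Real.norm_of_nonneg hρ0.le]
    constructor <;> nlinarith [norm_nonneg z]
  have hhd : ∀ w : ℂ, ‖w‖ < 1 → DifferentiableAt ℂ h w := fun w hw =>
    (hh w (by simpa using hw)).differentiableAt (Metric.isOpen_ball.mem_nhds (by simpa using hw))
  have hhs : ∀ z : ℂ, ‖z‖ ≤ 1 → DifferentiableAt ℂ (fun z => h ((ρ : ℂ) ^ 2 * z)) z := by
    intro z hz
    exact DifferentiableAt.comp (f := fun z : ℂ => (ρ : ℂ) ^ 2 * z) z (hhd _ (hmaps z hz).1)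
      (by fun_prop)
  -- Only the multiple of `B` is altered, so the trace is kept. The argument `ρ ^ 2 * z` is the
  -- reflection of a point `z` of the unit circle in the circle of radius `ρ`, so on `|z| = 1` the
  -- arguments of `S` and `h` agree.
  set g : ℂ → ℂ := fun z => T z + ρ ^ 2 * blaschke σ z * h (ρ ^ 2 * z) with hg
  have hgd : ∀ z : ℂ, ‖z‖ ≤ 1 → DifferentiableAt ℂ g z := by
    intro z hz
    have h1 := hT z hz
    have h2 := differentiableAt_blaschke hσ1 hz
    have h3 := hhs z hz
    exact h1.add ((h2.const_mul _).mul h3)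
  refine ⟨g, fun z => h z - ρ ^ 2 * h (ρ ^ 2 * z), fun z hz => ?_, fun z hz => ?_, fun z hz => ?_,
    fun z hz => ?_⟩
  · exact (hgd z (by simpa using (Metric.mem_ball.mp hz).le)).differentiableWithinAt
  · have hz' : ‖z‖ < 1 := by simpa using hz
    exact ((hhd z hz').sub ((hhs z hz'.le).const_mul _)).differentiableWithinAt
  · have hd : DiffContOnCl ℂ g (Metric.ball 0 1) := by
      apply DifferentiableOn.diffContOnCl
      rw [closure_ball _ one_ne_zero]
      exact fun w hw => (hgd w (by simpa using hw)).differentiableWithinAt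
    refine Complex.norm_le_of_forall_mem_frontier_norm_le Metric.isBounded_ball hd ?_
      (subset_closure hz)
    intro w hw
    rw [frontier_ball _ one_ne_zero] at hw
    have hw1 : ‖w‖ = 1 := by simpa using hw
    have hww : w * conj w = 1 := by rw [Complex.mul_conj, Complex.normSq_eq_norm_sq, hw1]; simp
    have hw0 : conj w ≠ 0 := right_ne_zero_of_mul_eq_one hww
    have hrefl : (ρ : ℂ) ^ 2 / conj w = ρ ^ 2 * w := by
      rw [div_eq_iff hw0, mul_assoc, hww, mul_one]
    have hwg : w * g w =
        blaschke σ w * (conj (S (ρ ^ 2 * w)) + (ρ ^ 2 * w) * h (ρ ^ 2 * w)) := by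
      have := hTS w (by linarith) hw1.le
      rw [hrefl] at this
      rw [hg, mul_add, mul_add, this]
      ring
    have hnorm : ‖g w‖ = ‖conj (S (ρ ^ 2 * w)) + (ρ ^ 2 * w) * h (ρ ^ 2 * w)‖ := by
      have := congrArg norm hwg
      rwa [norm_mul, norm_mul, hw1, norm_blaschke_of_norm_eq_one hσ1 hw1, one_mul, one_mul] at this
    rw [hnorm]
    refine norm_conj_add_le_of_sphere (K := fun w => w * h w) hρ0 hS
      (fun w hw => differentiableAt_id.mul (hhd w (by linarith))) ?_ (hmaps w hw1.le).2
    intro v hv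
    have hvv : v * conj v = ρ ^ 2 := by rw [Complex.mul_conj, Complex.normSq_eq_norm_sq, hv]; simp
    have hv0 : conj v ≠ 0 := by
      rw [map_ne_zero, ← norm_ne_zero_iff, hv]; exact hρ0.ne'
    have h1 := hTS v (by linarith) (by linarith)
    -- Points of the circle of radius `ρ` are their own reflections, so there the harmonic function
    -- is `v f v / B v`.
    rw [show (ρ : ℂ) ^ 2 / conj v = v by rw [div_eq_iff hv0, hvv]] at h1
    have h2 : v * f v = blaschke σ v * (conj (S v) + v * h v) := by
      rw [hfe v (by simpa using hv.trans_lt hρ1), mul_add, h1]; ring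
    have h3 := congrArg norm h2
    rw [norm_mul, norm_mul, hv] at h3
    have h4 := hB v hv
    have h5 := hM v hv
    have h6 := norm_nonneg (conj (S v) + v * h v)
    have h7 : 0 ≤ ‖f v‖ := norm_nonneg _
    nlinarith
  · simp only [hg]
    rw [hfe z hz]
    ring

/-! ### Upper bound for the interpolation constant -/

theorem sameTrace_of_eq_blaschke_mul {n : ℕ} {σ : Fin n → ℂ} (hσ : ∀ i, ‖σ i‖ < 1)
    {f g k : ℂ → ℂ} (hk : DifferentiableOn ℂ k disc)
    (h : ∀ z ∈ disc, f z - g z = blaschke σ z * k z) : SameTrace σ f g := by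
  intro z
  set s := Finset.univ.filter fun i => σ i = z with hs
  rcases s.eq_empty_or_nonempty with h0 | ⟨i, hi⟩
  · simp [h0]
  have hiz : σ i = z := by simpa [hs] using hi
  have hz : z ∈ disc := by simpa [hiz] using hσ i
  have hnhds : disc ∈ nhds z := Metric.isOpen_ball.mem_nhds hz
  -- The cofactor of `(w - z) ^ s.card`: the denominators of the factors vanishing at `z`, the
  -- remaining factors, and `k`.
  set q : ℂ → ℂ := fun w =>
    ((∏ i ∈ s, (1 - conj (σ i) * w)⁻¹) *
      ∏ i ∈ Finset.univ.filter fun i => ¬ σ i = z, (w - σ i) / (1 - conj (σ i) * w)) * k w with hq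
  have hqd : DifferentiableOn ℂ q disc := by
    refine DifferentiableOn.mul (DifferentiableOn.mul ?_ ?_) hk
    all_goals
      refine DifferentiableOn.fun_finsetProd fun i _ => ?_
      intro w hw
      have := one_sub_conj_mul_ne_zero (hσ i) (by simpa using (Metric.mem_ball.mp hw).le)
      apply DifferentiableAt.differentiableWithinAt
      fun_prop (disch := assumption)
  have hfac : ∀ w ∈ disc, f w - g w = (w - z) ^ s.card • q w := by
    intro w hw
    rw [h w hw, blaschke, ← Finset.prod_filter_mul_prod_filter_not Finset.univ (fun i => σ i = z),
      ← hs, hq]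
    have : ∏ i ∈ s, (w - σ i) / (1 - conj (σ i) * w) =
        (w - z) ^ s.card * ∏ i ∈ s, (1 - conj (σ i) * w)⁻¹ := by
      rw [← Finset.prod_const, ← Finset.prod_mul_distrib]
      refine Finset.prod_congr rfl fun i hi => ?_
      have : σ i = z := by simpa [hs] using hi
      rw [this, div_eq_mul_inv]
    rw [this, smul_eq_mul]
    ring
  have hqa : AnalyticAt ℂ q z := hqd.analyticAt hnhds
  have hev : ∀ᶠ w in nhds z, f w - g w = (w - z) ^ s.card • q w :=
    Filter.eventually_of_mem hnhds hfac
  have hfa : AnalyticAt ℂ (fun w => f w - g w) z := by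
    refine AnalyticAt.congr ?_ (hev.mono fun w hw => hw.symm)
    fun_prop
  exact (natCast_le_analyticOrderAt hfa).mpr ⟨q, hqa, hev⟩

theorem supNorm_le_ofReal {g : ℂ → ℂ} {M : ℝ} (h : ∀ z ∈ disc, ‖g z‖ ≤ M) :
    supNorm g ≤ ENNReal.ofReal M := by
  refine iSup₂_le fun z hz => ?_
  rw [← ofReal_norm]
  exact ENNReal.ofReal_le_ofReal (h z hz)

theorem worstInterpConst_le {N : (ℂ → ℂ) → ℝ≥0∞} {s C : ℝ}
    (hU : ∀ f ∈ unitBall N, ∀ w ∈ disc, ‖f w‖ ≤ C * (1 - ‖w‖) ^ (-s)) {n : ℕ} {r : ℝ}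
    (hn : 1 ≤ n) (hr0 : 0 ≤ r) (hr1 : r < 1) :
    worstInterpConst N n r ≤ ENNReal.ofReal (2 * C * 8 ^ s * ((n : ℝ) / (1 - r)) ^ s) := by
  refine iSup₂_le fun σ hσ => iSup₂_le fun f hf => ?_
  have hn' : (1 : ℝ) ≤ n := by exact_mod_cast hn
  have h1r : 0 < 1 - r := by linarith
  have hpos : 0 < (1 - r) / (8 * n) := by positivity
  have hlt : (1 - r) / (8 * n) < 1 - r := by
    rw [div_lt_iff₀ (by positivity)]; nlinarith
  obtain ⟨g, k, hg, hk, hgM, hfg⟩ := exists_bounded_interpolant (ρ := 1 - (1 - r) / (8 * n))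
    (M := C * ((1 - r) / (8 * n)) ^ (-s)) (by linarith) (by linarith) hr0 hf.1 σ
    (fun i => (hσ i).2)
    (fun w hw => by
      have := hU f hf w (by simp [hw, hpos])
      rwa [hw, sub_sub_cancel] at this)
    (fun w hw => half_le_norm_blaschke hn hr1 (fun i => (hσ i).2) hw)
  have hb := supNorm_le_ofReal hgM
  refine (iInf₂_le g ⟨⟨hg, hb.trans_lt ENNReal.ofReal_lt_top⟩,
    sameTrace_of_eq_blaschke_mul (fun i => by simpa using (hσ i).1) hk hfg⟩).trans (hb.trans ?_)
  apply ENNReal.ofReal_le_ofReal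
  apply le_of_eq
  rw [Real.rpow_neg hpos.le, ← Real.inv_rpow hpos.le, inv_div, mul_div_assoc,
    Real.mul_rpow (by norm_num) (by positivity)]
  ring

/-! ### Lower bound for a repeated node -/

/-- Schwarz lemma for a bounded function with a zero of order at least `n` at `a`. -/
theorem norm_le_mul_blaschke_factor_pow {h : ℂ → ℂ} (hd : DifferentiableOn ℂ h disc) {K : ℝ}
    (hK : ∀ z ∈ disc, ‖h z‖ ≤ K) {a : ℂ} (ha : ‖a‖ < 1) {n : ℕ} (hn : 1 ≤ n)
    (hord : (n : ℕ∞) ≤ analyticOrderAt h a) {z : ℂ} (hz : z ∈ disc) :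
    ‖h z‖ ≤ K * ‖(z - a) / (1 - conj a * z)‖ ^ n := by
  obtain ⟨m, rfl⟩ : ∃ m, n = m + 1 := ⟨n - 1, by omega⟩
  have haD : a ∈ disc := by simpa using ha
  have hz1 : ‖z‖ < 1 := by simpa using hz
  have hane : ∀ v : ℂ, ‖v‖ < 1 → 1 + conj a * v ≠ 0 := by
    intro v hv
    have := one_sub_conj_mul_ne_zero (z := -v) ha (by simpa using hv.le)
    simpa [sub_neg_eq_add] using this
  -- The automorphism sending `0` to `a` reduces the claim to the higher-order Schwarz lemma at the
  -- origin.
  set μ : ℂ → ℂ := fun v => (v + a) / (1 + conj a * v) with hμ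
  have hμd : ∀ v : ℂ, ‖v‖ < 1 → DifferentiableAt ℂ μ v := by
    intro v hv
    have := hane v hv
    rw [hμ]
    fun_prop (disch := assumption)
  have hμm : Set.MapsTo μ (Metric.ball 0 1) disc := by
    intro v hv
    have hv1 : ‖v‖ < 1 := by simpa using hv
    have h0 := norm_pos_iff.mpr (hane v hv1)
    have := norm_sq_one_sub_conj_mul_sub (-a) v
    simp only [map_neg, sub_neg_eq_add, neg_mul, norm_neg] at this
    have hp : 0 < (1 - ‖a‖ ^ 2) * (1 - ‖v‖ ^ 2) := by
      apply mul_pos <;> nlinarith [norm_nonneg a, norm_nonneg v]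
    rw [mem_ball_zero_iff, hμ, norm_div, div_lt_one h0]
    exact lt_of_pow_lt_pow_left₀ 2 h0.le (by linarith)
  have hμ0 : μ 0 = a := by simp [hμ]
  have hha : h a = 0 := apply_eq_zero_of_analyticOrderAt_ne_zero (𝕜 := ℂ) (by
    intro h0; rw [h0] at hord; simp at hord)
  have han : AnalyticAt ℂ h a := hd.analyticAt (Metric.isOpen_ball.mem_nhds haD)
  obtain ⟨q, hq, hqe⟩ := (natCast_le_analyticOrderAt han).mp hord
  -- Vanishing to order `m + 1` is used in the form `o(|w - a| ^ m)`, which the Schwarz lemma takes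
  -- as hypothesis to yield the power `m + 1`.
  have hlo : h =o[nhds a] fun w => ‖w - a‖ ^ m := by
    have h1 : h =O[nhds a] fun w => (w - a) ^ (m + 1) := by
      have h2 : (fun w => (w - a) ^ (m + 1) • q w) =O[nhds a] fun w => (w - a) ^ (m + 1) * 1 := by
        simp only [smul_eq_mul]
        exact (Asymptotics.isBigO_refl _ _).mul
          (hq.continuousAt.tendsto.isBigO_one ℂ)
      simpa using (Filter.EventuallyEq.trans_isBigO hqe h2)
    refine h1.trans_isLittleO ?_
    have h3 : (fun w : ℂ => w - a) =o[nhds a] fun _ => (1 : ℂ) := by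
      rw [Asymptotics.isLittleO_one_iff]
      have : Filter.Tendsto (fun w : ℂ => w - a) (nhds a) (nhds (a - a)) :=
        (continuous_id.sub continuous_const).tendsto a
      simpa using this
    have h4 := (Asymptotics.isBigO_refl (fun w : ℂ => (w - a) ^ m) (nhds a)).mul_isLittleO h3
    simp only [← pow_succ, mul_one] at h4
    refine h4.trans_isBigO ?_
    have := (Asymptotics.isBigO_refl (fun w : ℂ => (w - a) ^ m) (nhds a)).norm_right
    simpa using this
  have hμ0' : Filter.Tendsto μ (nhds 0) (nhds a) := by
    have := (hμd 0 (by simp)).continuousAt.tendsto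
    rwa [hμ0] at this
  have hcomp : (fun v => (h ∘ μ) v - (h ∘ μ) 0) =o[nhds 0] fun v => ‖v - 0‖ ^ m := by
    simp only [Function.comp_apply, hμ0, hha, sub_zero]
    have h1 := hlo.comp_tendsto hμ0'
    refine h1.trans_isBigO ?_
    have h2 : (fun v => μ v - a) =O[nhds 0] fun v => v - 0 := by
      have := (hμd 0 (by simp)).isBigO_sub
      rwa [hμ0] at this
    simpa [Function.comp_def] using! h2.norm_norm.pow m
  set v := (z - a) / (1 - conj a * z) with hv
  have hne := one_sub_conj_mul_ne_zero ha hz1.le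
  have hv1 : v ∈ Metric.ball (0 : ℂ) 1 := by
    have h0 := norm_pos_iff.mpr hne
    have := norm_sq_one_sub_conj_mul_sub a z
    have hp : 0 < (1 - ‖a‖ ^ 2) * (1 - ‖z‖ ^ 2) := by
      apply mul_pos <;> nlinarith [norm_nonneg a, norm_nonneg z]
    rw [mem_ball_zero_iff, hv, norm_div, div_lt_one h0]
    exact lt_of_pow_lt_pow_left₀ 2 h0.le (by linarith)
  have hμv : μ v = z := by
    have h1 := hane v (by simpa using hv1)
    rw [hμ]
    simp only
    rw [div_eq_iff h1, hv]
    have hne' : 1 - z * conj a ≠ 0 := by rwa [mul_comm z]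
    field_simp
    ring
  have hmaps : Set.MapsTo (h ∘ μ) (Metric.ball 0 1) (Metric.closedBall ((h ∘ μ) 0) K) := by
    intro w hw
    simpa [hμ0, hha] using hK _ (hμm hw)
  have hcd : DifferentiableOn ℂ (h ∘ μ) (Metric.ball 0 1) :=
    hd.comp (fun w hw => (hμd w (by simpa using hw)).differentiableWithinAt) hμm
  have := Complex.dist_le_mul_div_pow_of_mapsTo_ball_of_isLittleO hcd hmaps hcomp hv1
  simpa [hμ0, hha, hμv] using this

/-- The multiple `κ / (1 - conj ζ w) ^ k` of a power of the Cauchy kernel, with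
`κ = c (1 - |ζ|) ^ (k - s)`. -/
def testFun (c s : ℝ) (k : ℕ) (ζ w : ℂ) : ℂ :=
  ((c * (1 - ‖ζ‖) ^ ((k : ℝ) - s) : ℝ) : ℂ) / (1 - conj ζ * w) ^ k

theorem one_sub_norm_le {ζ w : ℂ} (hw : ‖w‖ ≤ 1) : 1 - ‖ζ‖ ≤ ‖1 - conj ζ * w‖ := by
  have := norm_sub_norm_le 1 (conj ζ * w)
  rw [norm_mul, RCLike.norm_conj, norm_one] at this
  nlinarith [norm_nonneg ζ, norm_nonneg w]

theorem norm_testFun {c s : ℝ} (hc : 0 < c) {k : ℕ} {ζ : ℂ} (hζ : ‖ζ‖ < 1) (w : ℂ) :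
    ‖testFun c s k ζ w‖ = c * (1 - ‖ζ‖) ^ ((k : ℝ) - s) / ‖1 - conj ζ * w‖ ^ k := by
  have : 0 < 1 - ‖ζ‖ := by linarith
  rw [testFun, norm_div, norm_pow, Complex.norm_real, Real.norm_of_nonneg (by positivity)]

theorem rpow_sub_div_pow {δ s : ℝ} (hδ : 0 < δ) (k : ℕ) :
    δ ^ ((k : ℝ) - s) / δ ^ k = δ ^ (-s) := by
  rw [← Real.rpow_natCast, ← Real.rpow_sub hδ]
  congr 1
  ring

theorem norm_testFun_le {c s : ℝ} (hc : 0 < c) {k : ℕ} {ζ w : ℂ} (hζ : ‖ζ‖ < 1) (hw : ‖w‖ ≤ 1) :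
    ‖testFun c s k ζ w‖ ≤ c * (1 - ‖ζ‖) ^ (-s) := by
  have h0 : 0 < 1 - ‖ζ‖ := by linarith
  rw [norm_testFun hc hζ, ← rpow_sub_div_pow h0 k, mul_div_assoc]
  gcongr
  exact one_sub_norm_le hw

theorem norm_le_toReal_supNorm {g : ℂ → ℂ} (hg : g ∈ hInfty) {z : ℂ} (hz : z ∈ disc) :
    ‖g z‖ ≤ (supNorm g).toReal := by
  have h : ‖g z‖ₑ ≤ supNorm g := le_iSup₂ (f := fun z _ => ‖g z‖ₑ) z hz
  rw [← toReal_enorm]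
  exact ENNReal.toReal_mono hg.2.ne h

/-- The lower bound for `n` nodes that coincide. -/
theorem le_interpConst_const {N : (ℂ → ℂ) → ℝ≥0∞} {s c : ℝ} {k : ℕ} (hs : 0 ≤ s) (hc : 0 < c)
    (hk : 1 ≤ k) (hL : ∀ ζ ∈ disc, testFun c s k ζ ∈ unitBall N) {n : ℕ} (hn : 1 ≤ n) {a : ℂ}
    (ha : ‖a‖ < 1) :
    ENNReal.ofReal (c / 6 * (1 / (4 * k)) ^ s * ((n : ℝ) / (1 - ‖a‖)) ^ s) ≤
      interpConst N (fun _ : Fin n => a) := by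
  obtain ⟨u, hu, hau⟩ : ∃ u : ℂ, ‖u‖ = 1 ∧ a = ‖a‖ * u := by
    rcases eq_or_ne a 0 with h | h
    · exact ⟨1, by simp, by simp [h]⟩
    · refine ⟨a / ‖a‖, by simp [h], ?_⟩
      have : (‖a‖ : ℂ) ≠ 0 := by simpa using h
      field_simp
  have huu : conj u * u = 1 := by
    rw [mul_comm, Complex.mul_conj, Complex.normSq_eq_norm_sq, hu]; simp
  set r := ‖a‖ with hr
  have hr0 : 0 ≤ r := norm_nonneg a
  have hn' : (1 : ℝ) ≤ n := by exact_mod_cast hn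
  have hk' : (1 : ℝ) ≤ k := by exact_mod_cast hk
  have h1r : 0 < 1 - r := by linarith
  set P : ℝ := n / (1 - r) with hP
  have hP1 : 1 ≤ P := by rw [hP, le_div_iff₀ h1r]; linarith
  set A : ℝ := 4 * k with hA
  have hA4 : 4 ≤ A := by linarith
  -- The kernel's parameter `t * u` and the test point `x * u` lie on the ray through `a`, with `1 -
  -- t = A / (A + P)` and `1 - x = 1 / P`. Then `1 - t x` exceeds `1 - t` only by the factor `1 + 1
  -- / A`, and `A = 4 k` limits the loss in its `k`-th power to `3/4`.
  set t : ℝ := P / (A + P) with ht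
  have ht0 : 0 ≤ t := by positivity
  have hδ : 1 - t = A / (A + P) := by rw [ht]; field_simp; ring
  have hδ0 : 0 < 1 - t := by rw [hδ]; positivity
  set x : ℝ := 1 - 1 / P with hx
  have hx0 : 0 ≤ x := by
    have : 1 / P ≤ 1 := by rw [div_le_one (by linarith)]; exact hP1
    linarith
  have hx1 : x < 1 := by
    have : 0 < 1 / P := by positivity
    linarith
  have hζn : ‖(t : ℂ) * u‖ = t := by
    rw [norm_mul, hu, Complex.norm_real, Real.norm_of_nonneg ht0, mul_one]
  have hXn : ‖(x : ℂ) * u‖ = x := by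
    rw [norm_mul, hu, Complex.norm_real, Real.norm_of_nonneg hx0, mul_one]
  have hXD : (x : ℂ) * u ∈ disc := by rw [mem_ball_zero_iff, hXn]; exact hx1
  have hζD : (t : ℂ) * u ∈ disc := by rw [mem_ball_zero_iff, hζn]; linarith
  set f := testFun c s k ((t : ℂ) * u) with hf
  set M := c * (1 - t) ^ (-s) with hM
  have hM0 : 0 < M := by positivity
  have hfM : ∀ z ∈ disc, ‖f z‖ ≤ M := by
    intro z hz
    have := norm_testFun_le (s := s) (k := k) hc (hζn.trans_lt (by linarith))
      (w := z) (by simpa using (Metric.mem_ball.mp hz).le)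
    rwa [hζn] at this
  have hfX : 3 / 4 * M ≤ ‖f (x * u)‖ := by
    have h1 : ‖1 - conj ((t : ℂ) * u) * (x * u)‖ = (1 - t) * ((A + 1) / A) := by
      have e : 1 - conj ((t : ℂ) * u) * (x * u) = ((1 - t * x : ℝ) : ℂ) := by
        rw [map_mul, Complex.conj_ofReal]
        push_cast
        linear_combination (-(t : ℂ) * x) * huu
      rw [e, Complex.norm_real, Real.norm_of_nonneg (by nlinarith), hδ, ht, hx]
      field_simp
      ring
    have h2 : 3 / 4 ≤ (A / (A + 1)) ^ k := by
      have h3 := one_add_mul_le_pow (a := -(1 / (A + 1))) (by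
        have : 1 / (A + 1) ≤ 1 := by rw [div_le_one (by linarith)]; linarith
        linarith) k
      have h4 : 1 + -(1 / (A + 1)) = A / (A + 1) := by field_simp; ring
      rw [h4] at h3
      refine le_trans ?_ h3
      have h5 : (k : ℝ) * (1 / (A + 1)) ≤ 1 / 4 := by
        rw [mul_one_div, div_le_iff₀ (by linarith)]; linarith
      linarith
    rw [hf, norm_testFun hc (hζn.trans_lt (by linarith)), h1, hζn, hM, ← rpow_sub_div_pow hδ0 k]
    calc 3 / 4 * (c * ((1 - t) ^ ((k : ℝ) - s) / (1 - t) ^ k))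
        ≤ (A / (A + 1)) ^ k * (c * ((1 - t) ^ ((k : ℝ) - s) / (1 - t) ^ k)) := by gcongr
      _ = _ := by
        rw [mul_pow, div_pow, div_pow]
        field_simp
  have hb : ‖((x : ℂ) * u - a) / (1 - conj a * (x * u))‖ ^ n ≤ 1 / 2 := by
    have e1 : (x : ℂ) * u - a = ((x - r : ℝ) : ℂ) * u := by
      push_cast; linear_combination -hau
    have e2 : 1 - conj a * (x * u) = ((1 - r * x : ℝ) : ℂ) := by
      rw [hau, map_mul, Complex.conj_ofReal]
      push_cast
      linear_combination (-(r : ℂ) * x) * huu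
    have hy : 1 / P = (1 - r) * (1 / n) := by rw [hP]; field_simp
    have hy1 : 1 / (n : ℝ) ≤ 1 := by rw [div_le_one (by linarith)]; exact hn'
    have hy0 : 0 < 1 / (n : ℝ) := by positivity
    have hxr : x - r = (1 - r) * (1 - 1 / n) := by rw [hx, hy]; ring
    have hxr0 : 0 ≤ x - r := by rw [hxr]; apply mul_nonneg <;> linarith
    have hrx : 1 - r ≤ 1 - r * x := by nlinarith
    have hle : (x - r) / (1 - r * x) ≤ 1 - 1 / n := by
      rw [div_le_iff₀ (by linarith), hxr, mul_comm]
      gcongr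
    rw [e1, e2, norm_div, norm_mul, hu, mul_one, Complex.norm_real, Complex.norm_real,
      Real.norm_of_nonneg hxr0, Real.norm_of_nonneg (by linarith)]
    calc ((x - r) / (1 - r * x)) ^ n ≤ (1 - 1 / n) ^ n := by
          gcongr
          apply div_nonneg <;> linarith
      _ ≤ Real.exp (-1) := Real.one_sub_div_pow_le_exp_neg hn'
      _ ≤ 1 / 2 := by
          rw [Real.exp_neg, one_div]
          apply inv_anti₀ (by norm_num)
          linarith [Real.add_one_le_exp (1 : ℝ)]
  have hmain : ∀ g ∈ {g | g ∈ hInfty ∧ SameTrace (fun _ : Fin n => a) f g},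
      ENNReal.ofReal (M / 6) ≤ supNorm g := by
    rintro g ⟨hg, hfg⟩
    set G := (supNorm g).toReal with hG
    have hgG : ∀ z ∈ disc, ‖g z‖ ≤ G := fun z hz => norm_le_toReal_supNorm hg hz
    have hord : (n : ℕ∞) ≤ analyticOrderAt (fun w => f w - g w) a := by
      simpa using hfg a
    have hsch := norm_le_mul_blaschke_factor_pow (h := fun w => f w - g w) (K := M + G)
      ((hL _ hζD).1.sub hg.1)
      (fun z hz => (norm_sub_le _ _).trans (add_le_add (hfM z hz) (hgG z hz))) ha hn hord hXD
    have h1 := norm_sub_norm_le (f (x * u)) (g (x * u))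
    have h2 := hgG _ hXD
    have hG0 : 0 ≤ G := ENNReal.toReal_nonneg
    -- Together with `3 M / 4 - G ≤ ‖f X - g X‖` at `X = x * u`, this gives `3 M / 4 - G ≤ (M + G) /
    -- 2`, that is, `G ≥ M / 6`.
    have h3 : (M + G) * ‖((x : ℂ) * u - a) / (1 - conj a * (x * u))‖ ^ n ≤ (M + G) * (1 / 2) := by
      gcongr
    rw [← ENNReal.ofReal_toReal hg.2.ne]
    apply ENNReal.ofReal_le_ofReal
    linarith
  refine le_trans ?_ (le_iSup₂ (f := fun f _ => ⨅ g ∈ {g | g ∈ hInfty ∧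
    SameTrace (fun _ : Fin n => a) f g}, supNorm g) f (hL _ hζD))
  refine le_trans ?_ (le_iInf₂ hmain)
  apply ENNReal.ofReal_le_ofReal
  have h1 : (1 / A) ^ s * P ^ s ≤ (1 - t) ^ (-s) := by
    rw [Real.rpow_neg hδ0.le, ← Real.inv_rpow hδ0.le, hδ, inv_div,
      ← Real.mul_rpow (by positivity) (by positivity)]
    apply Real.rpow_le_rpow (by positivity) _ hs
    rw [one_div_mul_eq_div]
    gcongr
    linarith
  rw [hM]
  calc c / 6 * (1 / A) ^ s * P ^ s = c / 6 * ((1 / A) ^ s * P ^ s) := by ring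
    _ ≤ c / 6 * (1 - t) ^ (-s) := by gcongr
    _ = _ := by ring

/-! ### Evaluation norms and the two-sided estimates -/

theorem evalNorm_le {N : (ℂ → ℂ) → ℝ≥0∞} {s C : ℝ}
    (hU : ∀ f ∈ unitBall N, ∀ w ∈ disc, ‖f w‖ ≤ C * (1 - ‖w‖) ^ (-s)) {t : ℝ} (ht0 : 0 ≤ t)
    (ht1 : t < 1) : evalNorm N (t : ℂ) ≤ ENNReal.ofReal (C * (1 - t) ^ (-s)) := by
  refine iSup₂_le fun f hf => ?_
  have htn : ‖(t : ℂ)‖ = t := by simpa using ht0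
  have := hU f hf t (by rw [mem_ball_zero_iff, htn]; exact ht1)
  rw [htn] at this
  rw [← ofReal_norm]
  exact ENNReal.ofReal_le_ofReal this

theorem le_evalNorm {N : (ℂ → ℂ) → ℝ≥0∞} {s c : ℝ} {k : ℕ} (hc : 0 < c)
    (hL : ∀ ζ ∈ disc, testFun c s k ζ ∈ unitBall N) {t : ℝ} (ht0 : 0 ≤ t)
    (ht1 : t < 1) : ENNReal.ofReal (c / 2 ^ k * (1 - t) ^ (-s)) ≤ evalNorm N (t : ℂ) := by
  have htn : ‖(t : ℂ)‖ = t := by simpa using ht0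
  have h0 : 0 < 1 - t := by linarith
  refine le_trans ?_ (le_iSup₂ (f := fun (f : ℂ → ℂ) (_ : f ∈ unitBall N) => ‖f t‖ₑ)
    (testFun c s k t) (hL t (by rw [mem_ball_zero_iff, htn]; exact ht1)))
  rw [← ofReal_norm, norm_testFun hc (htn.trans_lt ht1), htn]
  apply ENNReal.ofReal_le_ofReal
  have e : ‖1 - conj (t : ℂ) * t‖ = (1 - t) * (1 + t) := by
    have : 1 - conj (t : ℂ) * t = (((1 - t) * (1 + t) : ℝ) : ℂ) := by
      rw [Complex.conj_ofReal]; push_cast; ring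
    rw [this, Complex.norm_real, Real.norm_of_nonneg (by positivity)]
  rw [e, ← rpow_sub_div_pow h0 k, mul_pow]
  have : (1 + t) ^ k ≤ 2 ^ k := by gcongr; linarith
  calc c / 2 ^ k * ((1 - t) ^ ((k : ℝ) - s) / (1 - t) ^ k)
      = c * (1 - t) ^ ((k : ℝ) - s) / ((1 - t) ^ k * 2 ^ k) := by field_simp
    _ ≤ _ := by gcongr

/-- Two-sided estimates for the interpolation constants of a space whose evaluation functionals
grow like `(1 - |w|) ^ (-s)` and whose unit ball contains normalized powers of Cauchy kernels. -/
theorem interpConst_estimates {N : (ℂ → ℂ) → ℝ≥0∞} {s c C : ℝ} {k : ℕ} (hs : 0 ≤ s) (hc : 0 < c)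
    (hC : 0 < C) (hk : 1 ≤ k)
    (hU : ∀ f ∈ unitBall N, ∀ w ∈ disc, ‖f w‖ ≤ C * (1 - ‖w‖) ^ (-s))
    (hL : ∀ ζ ∈ disc, testFun c s k ζ ∈ unitBall N) :
    ∃ a b : ℝ, 0 < a ∧ 0 < b ∧ ∀ (n : ℕ) (r : ℝ), 1 ≤ n → 0 ≤ r → r < 1 →
      ENNReal.ofReal (a * ((n : ℝ) / (1 - r)) ^ s) ≤ worstInterpConst N n r ∧
      worstInterpConst N n r ≤ ENNReal.ofReal (b * ((n : ℝ) / (1 - r)) ^ s) ∧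
      (∀ z : ℂ, ‖z‖ = r →
        ENNReal.ofReal (a * ((n : ℝ) / (1 - r)) ^ s) ≤ interpConst N (fun _ : Fin n => z)) ∧
      ENNReal.ofReal a * evalNorm N ((1 - (1 - r) / (n : ℝ) : ℝ) : ℂ) ≤ worstInterpConst N n r ∧
      worstInterpConst N n r ≤ ENNReal.ofReal b * evalNorm N ((1 - (1 - r) / (n : ℝ) : ℝ) : ℂ) := by
  have hk' : (1 : ℝ) ≤ k := by exact_mod_cast hk
  set a₀ : ℝ := c / 6 * (1 / (4 * k)) ^ s with ha₀
  set b₀ : ℝ := 2 * C * 8 ^ s with hb₀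
  have ha₀0 : 0 < a₀ := by positivity
  have hb₀0 : 0 < b₀ := by positivity
  refine ⟨min a₀ (a₀ / C), max b₀ (b₀ * (2 ^ k / c)), by positivity, by positivity, ?_⟩
  intro n r hn hr0 hr1
  have hn' : (1 : ℝ) ≤ n := by exact_mod_cast hn
  have h1r : 0 < 1 - r := by linarith
  have hlow : ∀ z : ℂ, ‖z‖ = r →
      ENNReal.ofReal (a₀ * ((n : ℝ) / (1 - r)) ^ s) ≤ interpConst N (fun _ : Fin n => z) := by
    intro z hz
    have := le_interpConst_const hs hc hk hL hn (a := z) (by linarith)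
    rwa [hz] at this
  have hworst : ENNReal.ofReal (a₀ * ((n : ℝ) / (1 - r)) ^ s) ≤ worstInterpConst N n r := by
    have hrn : ‖(r : ℂ)‖ = r := by simpa using hr0
    refine (hlow r hrn).trans ?_
    refine le_iSup₂ (f := fun (σ : Fin n → ℂ) (_ : σ ∈ {σ : Fin n → ℂ | ∀ i, σ i ∈ disc ∧ ‖σ i‖ ≤ r})
      => interpConst N σ) (fun _ => (r : ℂ)) ?_
    intro i
    exact ⟨by rw [mem_ball_zero_iff, hrn]; exact hr1, hrn.le⟩
  have hupp := worstInterpConst_le hU hn hr0 hr1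
  rw [← hb₀] at hupp
  have hpos : 0 < (1 - r) / n := by positivity
  have hle1 : (1 - r) / n ≤ 1 := by rw [div_le_one (by positivity)]; linarith
  -- At this point the evaluation norm is itself comparable to `(n / (1 - r)) ^ s`, so the two forms
  -- of the estimate are equivalent.
  have hpw : (1 - (1 - (1 - r) / (n : ℝ))) ^ (-s) = ((n : ℝ) / (1 - r)) ^ s := by
    rw [sub_sub_cancel, Real.rpow_neg hpos.le, ← Real.inv_rpow hpos.le, inv_div]
  have hev1 := evalNorm_le hU (t := 1 - (1 - r) / n) (by linarith) (by linarith)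
  have hev2 := le_evalNorm hc hL (t := 1 - (1 - r) / n) (by linarith) (by linarith)
  rw [hpw] at hev1 hev2
  set Q := ((n : ℝ) / (1 - r)) ^ s with hQ
  have hQ0 : 0 < Q := by positivity
  have hmin : ENNReal.ofReal (min a₀ (a₀ / C) * Q) ≤ ENNReal.ofReal (a₀ * Q) := by
    apply ENNReal.ofReal_le_ofReal
    gcongr
    exact min_le_left _ _
  refine ⟨hmin.trans hworst, hupp.trans ?_, fun z hz => hmin.trans (hlow z hz), ?_, ?_⟩
  · apply ENNReal.ofReal_le_ofReal
    gcongr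
    exact le_max_left _ _
  · refine le_trans ?_ hworst
    calc _ ≤ ENNReal.ofReal (a₀ / C) * ENNReal.ofReal (C * Q) := by
          gcongr
          exact min_le_right _ _
      _ = _ := by
          rw [← ENNReal.ofReal_mul (by positivity)]
          congr 1
          field_simp
  · refine hupp.trans ?_
    calc ENNReal.ofReal (b₀ * Q)
        = ENNReal.ofReal (b₀ * (2 ^ k / c)) * ENNReal.ofReal (c / 2 ^ k * Q) := by
          rw [← ENNReal.ofReal_mul (by positivity)]
          congr 1
          field_simp
      _ ≤ _ := by
          gcongr
          exact le_max_right _ _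

/-! ### Hardy spaces and the Poisson kernel -/

/-- The `p`-th power of the integral mean over the circle of radius `ρ`. -/
def meanPow (p : ℝ) (f : ℂ → ℂ) (ρ : ℝ) : ℝ≥0∞ :=
  (ENNReal.ofReal (2 * Real.pi))⁻¹ *
    ∫⁻ θ in Set.Ioc (0 : ℝ) (2 * Real.pi), ‖f (circleMap 0 ρ θ)‖ₑ ^ p

theorem circleMap_sub_ne_zero {w : ℂ} {R : ℝ} (hw : ‖w‖ < R) (θ : ℝ) : circleMap 0 R θ - w ≠ 0 := by
  intro h
  have h1 : ‖circleMap 0 R θ‖ = R := by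
    rw [norm_circleMap_zero, abs_of_pos ((norm_nonneg w).trans_lt hw)]
  rw [sub_eq_zero.mp h] at h1
  linarith

theorem poissonKernel_circleMap {w : ℂ} {R : ℝ} (θ : ℝ) :
    poissonKernel 0 w (circleMap 0 R θ) = (R ^ 2 - ‖w‖ ^ 2) / ‖circleMap 0 R θ - w‖ ^ 2 := by
  simp [poissonKernel_def]

theorem continuous_poissonKernel_circleMap {w : ℂ} {R : ℝ} (hw : ‖w‖ < R) :
    Continuous fun θ => poissonKernel 0 w (circleMap 0 R θ) := by
  simp only [poissonKernel_circleMap]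
  refine Continuous.div (by fun_prop) (by fun_prop) fun θ => ?_
  exact pow_ne_zero _ (norm_ne_zero_iff.mpr (circleMap_sub_ne_zero hw θ))

theorem poissonKernel_circleMap_nonneg {w : ℂ} {R : ℝ} (hw : ‖w‖ < R) (θ : ℝ) :
    0 ≤ poissonKernel 0 w (circleMap 0 R θ) := by
  rw [poissonKernel_circleMap]
  apply div_nonneg _ (by positivity)
  nlinarith [norm_nonneg w]

theorem lintegral_poissonKernel {w : ℂ} {R : ℝ} (hw : ‖w‖ < R) :
    ∫⁻ θ in Set.Ioc (0 : ℝ) (2 * Real.pi), ENNReal.ofReal (poissonKernel 0 w (circleMap 0 R θ)) =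
      ENNReal.ofReal (2 * Real.pi) := by
  have h := DiffContOnCl.circleAverage_poissonKernel_smul (c := 0) (R := R) (w := w)
    (f := fun _ : ℂ => (1 : ℝ) • (1 : ℂ)) diffContOnCl_const (by simpa using hw)
  rw [Real.circleAverage_def] at h
  rw [← ofReal_integral_eq_lintegral_ofReal
    ((continuous_poissonKernel_circleMap hw).integrableOn_Ioc)
    (Filter.Eventually.of_forall fun θ => poissonKernel_circleMap_nonneg hw θ)]
  congr 1
  rw [← intervalIntegral.integral_of_le (by positivity)]
  have h2 : (((2 * Real.pi)⁻¹ * ∫ θ in (0 : ℝ)..2 * Real.pi,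
      poissonKernel 0 w (circleMap 0 R θ) : ℝ) : ℂ) = 1 := by
    rw [Complex.ofReal_mul, ← intervalIntegral.integral_ofReal]
    simpa [Complex.real_smul] using h
  have h3 : (2 * Real.pi)⁻¹ * ∫ θ in (0 : ℝ)..2 * Real.pi,
      poissonKernel 0 w (circleMap 0 R θ) = 1 := by exact_mod_cast h2
  have := Real.pi_pos
  field_simp at h3
  linarith

theorem poissonKernel_circleMap_le {w : ℂ} {R : ℝ} (hw : ‖w‖ < R) (hR : R ≤ 1) (θ : ℝ) :
    poissonKernel 0 w (circleMap 0 R θ) ≤ 2 / (R - ‖w‖) := by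
  have h0 : 0 < R - ‖w‖ := by linarith
  have h1 : R - ‖w‖ ≤ ‖circleMap 0 R θ - w‖ := by
    have := norm_sub_norm_le (circleMap 0 R θ) w
    rwa [norm_circleMap_zero, abs_of_pos ((norm_nonneg w).trans_lt hw)] at this
  rw [poissonKernel_circleMap]
  calc (R ^ 2 - ‖w‖ ^ 2) / ‖circleMap 0 R θ - w‖ ^ 2
      ≤ (2 * (R - ‖w‖)) / (R - ‖w‖) ^ 2 := by
        gcongr
        nlinarith [norm_nonneg w]
    _ = _ := by field_simp

/-- A pointwise bound by the integral mean over a larger circle. -/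
theorem enorm_rpow_le_meanPow {p : ℝ} (hp : 1 ≤ p) {f : ℂ → ℂ} (hf : DifferentiableOn ℂ f disc)
    {w : ℂ} {R : ℝ} (hw : ‖w‖ < R) (hR : R < 1) :
    ‖f w‖ₑ ^ p ≤ ENNReal.ofReal (2 / (R - ‖w‖)) * meanPow p f R := by
  have hπ := Real.pi_pos
  have hR0 : 0 < R := (norm_nonneg w).trans_lt hw
  have hcl : closure (Metric.ball (0 : ℂ) R) ⊆ disc := by
    rw [closure_ball _ hR0.ne']
    exact Metric.closedBall_subset_ball hR
  have hdc : DiffContOnCl ℂ f (Metric.ball 0 R) := (hf.mono hcl).diffContOnCl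
  have h := hdc.circleAverage_poissonKernel_smul (w := w) (by simpa using hw)
  rw [Real.circleAverage_def] at h
  set I := Set.Ioc (0 : ℝ) (2 * Real.pi) with hI
  set P : ℝ → ℝ := fun θ => poissonKernel 0 w (circleMap 0 R θ) with hP
  set F : ℝ → ℂ := fun θ => f (circleMap 0 R θ) with hF
  have hPc : Continuous P := continuous_poissonKernel_circleMap hw
  have hFc : Continuous F := by
    refine hf.continuousOn.comp_continuous (continuous_circleMap 0 R) fun θ => ?_
    rw [mem_ball_zero_iff, norm_circleMap_zero, abs_of_pos hR0]
    exact hR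
  set ρ : ℝ → ℝ≥0∞ := fun θ => (ENNReal.ofReal (2 * Real.pi))⁻¹ * ENNReal.ofReal (P θ) with hρ
  have hρm : Measurable ρ := by
    have := hPc.measurable
    fun_prop
  -- The Poisson kernel makes `ν` a probability measure, so its `L^1` norm is at most its `L^p`
  -- norm; this is Jensen's inequality for the Poisson formula.
  set ν := (volume.restrict I).withDensity ρ with hν
  have h2π : ENNReal.ofReal (2 * Real.pi) ≠ 0 := by simpa using hπ
  have hprob : IsProbabilityMeasure ν := by
    constructor
    rw [hν, withDensity_apply _ MeasurableSet.univ, Measure.restrict_univ,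
      lintegral_const_mul _ (by fun_prop), lintegral_poissonKernel hw,
      ENNReal.inv_mul_cancel h2π ENNReal.ofReal_ne_top]
  have hlint : ∀ q : ℝ, 0 ≤ q → ∫⁻ θ, ‖F θ‖ₑ ^ q ∂ν = ∫⁻ θ in I, ρ θ * ‖F θ‖ₑ ^ q := by
    intro q hq
    rw [hν, lintegral_withDensity_eq_lintegral_mul _ hρm (by
      have := hFc.measurable
      fun_prop)]
    rfl
  have h1 : ‖f w‖ₑ ≤ ∫⁻ θ, ‖F θ‖ₑ ^ (1 : ℝ) ∂ν := by
    rw [hlint 1 zero_le_one, ← h, enorm_smul, intervalIntegral.integral_of_le (by positivity)]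
    have e : ∀ θ, ρ θ * ‖F θ‖ₑ ^ (1 : ℝ) =
        (ENNReal.ofReal (2 * Real.pi))⁻¹ * (ENNReal.ofReal (P θ) * ‖F θ‖ₑ) := by
      intro θ; rw [ENNReal.rpow_one, hρ, mul_assoc]
    simp only [e]
    rw [lintegral_const_mul _ (by
      have := hFc.measurable
      have := hPc.measurable
      fun_prop)]
    gcongr
    · rw [enorm_inv (by positivity), Real.enorm_of_nonneg (by positivity)]
    · refine (enorm_integral_le_lintegral_enorm _).trans (lintegral_mono fun θ => ?_)
      simp only [Pi.smul_apply', enorm_smul]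
      rw [Real.enorm_of_nonneg (poissonKernel_circleMap_nonneg hw θ)]
  have h2 := eLpNorm'_le_eLpNorm'_of_exponent_le (f := F) one_pos hp ν
    hFc.aestronglyMeasurable
  simp only [eLpNorm', div_one, ENNReal.rpow_one (∫⁻ a, _ ∂ν)] at h2
  have h3 := ENNReal.rpow_le_rpow (h1.trans h2) (by linarith : (0 : ℝ) ≤ p)
  rw [← ENNReal.rpow_mul, one_div_mul_cancel (by linarith), ENNReal.rpow_one,
    hlint p (by linarith)] at h3
  refine h3.trans ?_
  rw [meanPow, ← mul_assoc, ← lintegral_const_mul _ (hFc.measurable.enorm.pow_const p)]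
  refine lintegral_mono fun θ => ?_
  simp only [hρ]
  rw [mul_comm (ENNReal.ofReal (2 / _))]
  gcongr
  exact poissonKernel_circleMap_le hw hR.le θ

theorem hardyNorm_pointwise {p : ℝ} (hp : 1 ≤ p) {f : ℂ → ℂ} (hf : f ∈ unitBall (hardyNorm p))
    {w : ℂ} (hw : w ∈ disc) : ‖f w‖ ≤ 4 ^ (1 / p) * (1 - ‖w‖) ^ (-(1 / p)) := by
  have hw1 : ‖w‖ < 1 := by simpa using hw
  have hd : 0 < 1 - ‖w‖ := by linarith
  have hp0 : 0 < p := by linarith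
  set R := 1 - (1 - ‖w‖) / 2 with hR
  have hm : meanPow p f R ≤ 1 := by
    have h1 : circleMean p f R ≤ 1 := by
      refine le_trans ?_ hf.2
      refine le_iSup₂ (f := fun ρ (_ : ρ ∈ Set.Ico (0 : ℝ) 1) => circleMean p f ρ) R
        ⟨?_, ?_⟩ <;> linarith [norm_nonneg w]
    have h2 := ENNReal.rpow_le_rpow h1 hp0.le
    rwa [circleMean, ← ENNReal.rpow_mul, one_div_mul_cancel hp0.ne', ENNReal.rpow_one,
      ENNReal.one_rpow] at h2
  have h := enorm_rpow_le_meanPow hp hf.1 (w := w) (R := R) (by linarith) (by linarith)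
  have h' : ENNReal.ofReal (‖f w‖ ^ p) ≤ ENNReal.ofReal (4 * (1 - ‖w‖)⁻¹) := by
    rw [← ENNReal.ofReal_rpow_of_nonneg (norm_nonneg _) hp0.le, ofReal_norm]
    refine h.trans ?_
    have e : 2 / (R - ‖w‖) = 4 * (1 - ‖w‖)⁻¹ := by
      rw [show R - ‖w‖ = (1 - ‖w‖) / 2 by rw [hR]; ring]
      field_simp
      norm_num
    rw [e]
    exact mul_le_of_le_one_right' hm
  rw [ENNReal.ofReal_le_ofReal_iff (by positivity)] at h'
  have := Real.rpow_le_rpow (by positivity) h' (by positivity : 0 ≤ 1 / p)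
  rwa [← Real.rpow_mul (norm_nonneg _), mul_one_div_cancel hp0.ne', Real.rpow_one,
    Real.mul_rpow (by norm_num) (by positivity), Real.inv_rpow hd.le, ← Real.rpow_neg hd.le] at this

theorem differentiableOn_testFun (c s : ℝ) (k : ℕ) {ζ : ℂ} (hζ : ‖ζ‖ < 1) :
    DifferentiableOn ℂ (testFun c s k ζ) disc := by
  intro w hw
  have := one_sub_conj_mul_ne_zero hζ (z := w) (by simpa using (Metric.mem_ball.mp hw).le)
  have := pow_ne_zero k this
  apply DifferentiableAt.differentiableWithinAt
  unfold testFun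
  fun_prop (disch := assumption)

/-- Turns the Cauchy kernel on the circle of radius `ρ` into the denominator of the Poisson kernel
of the unit circle at `ρ * ζ`. -/
theorem norm_one_sub_conj_mul_circleMap (ζ : ℂ) (ρ θ : ℝ) :
    ‖1 - conj ζ * circleMap 0 ρ θ‖ = ‖circleMap 0 1 θ - ρ * ζ‖ := by
  set e := Complex.exp (θ * Complex.I) with he
  have h1 : e * conj e = 1 := by
    rw [Complex.mul_conj, Complex.normSq_eq_norm_sq, he, Complex.norm_exp_ofReal_mul_I]
    simp
  have h2 : ‖e‖ = 1 := Complex.norm_exp_ofReal_mul_I θ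
  have h3 : circleMap 0 1 θ - ρ * ζ = conj (1 - conj ζ * circleMap 0 ρ θ) * e := by
    simp only [circleMap, zero_add, ← he, map_sub, map_one, map_mul, Complex.conj_conj,
      Complex.conj_ofReal, Complex.ofReal_one, one_mul]
    linear_combination (ρ * ζ) * h1
  rw [h3, norm_mul, h2, mul_one, RCLike.norm_conj]

/-- The integral means of the test functions. -/
theorem meanPow_testFun_le {p c s : ℝ} {k : ℕ} (hc : 0 < c) (hp : 1 ≤ p) (hk : 2 ≤ k) {ζ : ℂ}
    (hζ : ‖ζ‖ < 1) {ρ : ℝ} (hρ0 : 0 ≤ ρ) (hρ1 : ρ < 1) :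
    meanPow p (testFun c s k ζ) ρ ≤
      ENNReal.ofReal (c ^ p * (1 - ‖ζ‖) ^ (k * p - s * p) * (1 - ‖ζ‖ * ρ) ^ (1 - k * p)) := by
  have hπ := Real.pi_pos
  have hk' : (2 : ℝ) ≤ k := by exact_mod_cast hk
  have hδ : 0 < 1 - ‖ζ‖ := by linarith
  have hζ0 := norm_nonneg ζ
  set q := ‖ζ‖ * ρ with hq
  have hq0 : 0 ≤ q := by positivity
  have hq1 : q < 1 := by nlinarith
  have hwn : ‖(ρ : ℂ) * ζ‖ = q := by
    rw [norm_mul, Complex.norm_real, Real.norm_of_nonneg hρ0, hq, mul_comm]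
  have hwlt : ‖(ρ : ℂ) * ζ‖ < 1 := by rw [hwn]; exact hq1
  set κ := c ^ p * (1 - ‖ζ‖) ^ (k * p - s * p) with hκ
  have hκ0 : 0 ≤ κ := by positivity
  have hkp : 2 ≤ k * p := by nlinarith
  have hpt : ∀ θ : ℝ, ‖testFun c s k ζ (circleMap 0 ρ θ)‖ₑ ^ p ≤
      ENNReal.ofReal (κ * (1 - q) ^ (1 - k * p)) *
        ENNReal.ofReal (poissonKernel 0 (ρ * ζ) (circleMap 0 1 θ)) := by
    intro θ
    rw [← ofReal_norm, ENNReal.ofReal_rpow_of_nonneg (norm_nonneg _) (by linarith),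
      ← ENNReal.ofReal_mul (by have : 0 < 1 - q := by linarith
                               positivity)]
    apply ENNReal.ofReal_le_ofReal
    rw [norm_testFun hc hζ, norm_one_sub_conj_mul_circleMap, poissonKernel_circleMap, hwn]
    have hD : 1 - q ≤ ‖circleMap 0 1 θ - ρ * ζ‖ := by
      have := norm_sub_norm_le (circleMap 0 1 θ) (ρ * ζ)
      rwa [hwn, norm_circleMap_zero, abs_one] at this
    set D := ‖circleMap 0 1 θ - ρ * ζ‖
    have hq' : 0 < 1 - q := by linarith
    have hD0 : 0 < D := by linarith
    have e1 : (c * (1 - ‖ζ‖) ^ ((k : ℝ) - s) / D ^ k) ^ p = κ * D ^ (-(k * p)) := by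
      rw [Real.div_rpow (by positivity) (by positivity), Real.mul_rpow hc.le (by positivity),
        ← Real.rpow_mul hδ.le, ← Real.rpow_natCast, ← Real.rpow_mul hD0.le, Real.rpow_neg hD0.le,
        sub_mul, div_eq_mul_inv]
    rw [e1]
    refine le_of_le_of_eq (mul_le_mul_of_nonneg_left ?_ hκ0) (mul_assoc κ _ _).symm
    -- Two powers of `1 / D` are kept for the Poisson kernel, whose total mass is known; the other
    -- `k * p - 2 ≥ 0` are bounded by `D ≥ 1 - q`.
    calc D ^ (-(k * p)) = D ^ (-(k * p - 2)) * (D ^ 2)⁻¹ := by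
          rw [← Real.rpow_natCast D 2, ← Real.rpow_neg hD0.le, ← Real.rpow_add hD0]
          congr 1
          push_cast
          ring
      _ ≤ (1 - q) ^ (-(k * p - 2)) * (D ^ 2)⁻¹ := by
          gcongr ?_ * _
          exact Real.rpow_le_rpow_of_nonpos hq' hD (by linarith)
      _ = (1 - q) ^ (1 - k * p) * ((1 - q) / D ^ 2) := by
          rw [show -(k * p - 2) = (1 - k * p) + 1 by ring, Real.rpow_add hq', Real.rpow_one]
          ring
      _ ≤ _ := by
          gcongr <;> nlinarith
  have h2π : ENNReal.ofReal (2 * Real.pi) ≠ 0 := by simpa using hπ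
  calc meanPow p (testFun c s k ζ) ρ
      ≤ (ENNReal.ofReal (2 * Real.pi))⁻¹ * ∫⁻ θ in Set.Ioc (0 : ℝ) (2 * Real.pi),
        ENNReal.ofReal (κ * (1 - q) ^ (1 - k * p)) *
        ENNReal.ofReal (poissonKernel 0 (ρ * ζ) (circleMap 0 1 θ)) := by
        unfold meanPow
        gcongr with θ
        exact hpt θ
    _ = _ := by
        rw [lintegral_const_mul _ (by
            have := (continuous_poissonKernel_circleMap hwlt).measurable
            fun_prop), lintegral_poissonKernel hwlt, mul_comm, mul_assoc,
          ENNReal.mul_inv_cancel h2π ENNReal.ofReal_ne_top, mul_one]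

theorem testFun_mem_unitBall_hardyNorm {p : ℝ} (hp : 1 ≤ p) {ζ : ℂ} (hζ : ζ ∈ disc) :
    testFun 1 (1 / p) 2 ζ ∈ unitBall (hardyNorm p) := by
  have hζ1 : ‖ζ‖ < 1 := by simpa using hζ
  have hp0 : 0 < p := by linarith
  refine ⟨differentiableOn_testFun _ _ _ hζ1, iSup₂_le fun ρ hρ => ?_⟩
  have h := meanPow_testFun_le (s := 1 / p) one_pos hp le_rfl hζ1 hρ.1 hρ.2
  have h1 : meanPow p (testFun 1 (1 / p) 2 ζ) ρ ≤ 1 := by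
    refine h.trans ?_
    rw [ENNReal.ofReal_le_one]
    have hδ : 0 < 1 - ‖ζ‖ := by linarith
    have hle : 1 - ‖ζ‖ ≤ 1 - ‖ζ‖ * ρ := by nlinarith [norm_nonneg ζ, hρ.1, hρ.2]
    have h2 := Real.rpow_le_rpow_of_nonpos hδ hle
      (by push_cast; linarith : 1 - ((2 : ℕ) : ℝ) * p ≤ 0)
    rw [Real.one_rpow, one_mul, one_div_mul_cancel hp0.ne']
    calc _ ≤ (1 - ‖ζ‖) ^ (((2 : ℕ) : ℝ) * p - 1) * (1 - ‖ζ‖) ^ (1 - ((2 : ℕ) : ℝ) * p) := by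
          gcongr
      _ = 1 := by rw [← Real.rpow_add hδ]; simp
  have h2 := ENNReal.rpow_le_rpow h1 (by positivity : 0 ≤ 1 / p)
  rwa [ENNReal.one_rpow] at h2

/-! ### Bergman spaces -/

/-- Integration in polar coordinates, with the angle in `(0, 2π]`. -/
theorem lintegral_eq_lintegral_circleMap {F : ℂ → ℝ≥0∞} (hF : Measurable F) :
    ∫⁻ z, F z = ∫⁻ ρ in Set.Ioi (0 : ℝ), ENNReal.ofReal ρ *
      ∫⁻ θ in Set.Ioc (0 : ℝ) (2 * Real.pi), F (circleMap 0 ρ θ) := by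
  have hm : Measurable fun q : ℝ × ℝ => F (circleMap 0 q.1 q.2) := by
    apply hF.comp
    unfold circleMap
    fun_prop
  have e : ∀ q : ℝ × ℝ, Complex.polarCoord.symm q = circleMap 0 q.1 q.2 := by
    intro q
    rw [Complex.polarCoord_symm_apply, circleMap, zero_add, Complex.exp_mul_I, Complex.ofReal_cos,
      Complex.ofReal_sin]
  rw [← Complex.lintegral_comp_polarCoord_symm]
  simp only [e, smul_eq_mul, polarCoord_target]
  rw [Measure.volume_eq_prod, ← Measure.prod_restrict, lintegral_prod _ (by fun_prop)]
  refine lintegral_congr fun ρ => ?_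
  have hmρ : Measurable fun θ : ℝ => F (circleMap 0 ρ θ) := by
    apply hF.comp
    unfold circleMap
    fun_prop
  simp only
  rw [lintegral_const_mul _ hmρ, setLIntegral_congr Ioo_ae_eq_Ioc]
  congr 1
  -- Both intervals are fundamental domains for translation by `2 * π`, under which the integrand is
  -- invariant.
  have h1 := isAddFundamentalDomain_Ioc Real.two_pi_pos (-Real.pi)
  have h2 := isAddFundamentalDomain_Ioc Real.two_pi_pos 0
  rw [show -Real.pi + 2 * Real.pi = Real.pi by ring] at h1
  rw [zero_add] at h2
  refine h1.setLIntegral_eq h2 _ ?_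
  rintro ⟨g, n, rfl⟩ θ
  have hper : Function.Periodic (fun θ : ℝ => F (circleMap 0 ρ θ)) (2 * Real.pi) :=
    (periodic_circleMap 0 ρ).comp F
  have := hper.zsmul n θ
  simpa [AddSubgroup.vadd_def, add_comm] using this

/-- The Bergman norm is a weighted integral of the integral means over circles. -/
theorem bergmanNorm_eq {p β : ℝ} (hp : 0 < p) {f : ℂ → ℂ} (hf : ContinuousOn f disc) :
    bergmanNorm p β f = (∫⁻ ρ in Set.Ioo (0 : ℝ) 1,
      ENNReal.ofReal (2 * ρ * (1 - ρ ^ 2) ^ β) * meanPow p f ρ) ^ (1 / p) := by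
  classical
  have hπ := Real.pi_pos
  unfold bergmanNorm
  congr 1
  set F : ℂ → ℝ≥0∞ := disc.indicator fun z => ‖f z‖ₑ ^ p * ENNReal.ofReal ((1 - ‖z‖ ^ 2) ^ β)
    with hF
  have hFm : Measurable F := by
    have hc : ContinuousOn (fun z : ℂ => ‖f z‖ ^ p * (1 - ‖z‖ ^ 2) ^ β) disc := by
      refine (hf.norm.rpow_const fun z _ => Or.inr hp.le).mul
        (ContinuousOn.rpow_const (by fun_prop) fun z hz => Or.inl ?_)
      have hz1 : ‖z‖ < 1 := by simpa using hz
      nlinarith [norm_nonneg z]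
    have h1 : Measurable (disc.indicator fun z : ℂ => ‖f z‖ ^ p * (1 - ‖z‖ ^ 2) ^ β) := by
      rw [← Set.piecewise_eq_indicator]
      exact hc.measurable_piecewise continuousOn_const Metric.isOpen_ball.measurableSet
    have h2 : F = fun z => ENNReal.ofReal
        (disc.indicator (fun z : ℂ => ‖f z‖ ^ p * (1 - ‖z‖ ^ 2) ^ β) z) := by
      funext z
      by_cases hz : z ∈ disc
      · rw [hF, Set.indicator_of_mem hz, Set.indicator_of_mem hz,
          ENNReal.ofReal_mul (by positivity),
          ← ENNReal.ofReal_rpow_of_nonneg (norm_nonneg _) hp.le, ofReal_norm]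
      · rw [hF, Set.indicator_of_notMem hz, Set.indicator_of_notMem hz, ENNReal.ofReal_zero]
    rw [h2]
    exact h1.ennreal_ofReal
  have hπ0 : ENNReal.ofReal Real.pi ≠ 0 := by simpa using hπ
  have hcirc : ∀ ρ ∈ Set.Ioi (0 : ℝ), (ENNReal.ofReal Real.pi)⁻¹ * (ENNReal.ofReal ρ *
      ∫⁻ θ in Set.Ioc (0 : ℝ) (2 * Real.pi), F (circleMap 0 ρ θ)) =
      (Set.Iio (1 : ℝ)).indicator
        (fun ρ => ENNReal.ofReal (2 * ρ * (1 - ρ ^ 2) ^ β) * meanPow p f ρ) ρ := by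
    intro ρ hρ
    have hρ0 : 0 < ρ := hρ
    have hn : ∀ θ, ‖circleMap 0 ρ θ‖ = ρ := fun θ => by
      rw [norm_circleMap_zero, abs_of_pos hρ0]
    by_cases h1 : ρ < 1
    · rw [Set.indicator_of_mem (Set.mem_Iio.mpr h1)]
      have hFe : ∀ θ, F (circleMap 0 ρ θ) =
          ‖f (circleMap 0 ρ θ)‖ₑ ^ p * ENNReal.ofReal ((1 - ρ ^ 2) ^ β) := fun θ => by
        rw [hF, Set.indicator_of_mem (by rw [mem_ball_zero_iff, hn]; exact h1), hn]
      simp only [hFe]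
      rw [lintegral_mul_const' _ _ ENNReal.ofReal_ne_top, meanPow,
        ENNReal.ofReal_mul (by positivity), ENNReal.ofReal_mul (by norm_num),
        ENNReal.ofReal_mul (by norm_num), ENNReal.mul_inv (Or.inr ENNReal.ofReal_ne_top)
          (Or.inl ENNReal.ofReal_ne_top)]
      set L := ∫⁻ θ in Set.Ioc (0 : ℝ) (2 * Real.pi), ‖f (circleMap 0 ρ θ)‖ₑ ^ p
      have h2 : ENNReal.ofReal 2 * (ENNReal.ofReal 2)⁻¹ = 1 :=
        ENNReal.mul_inv_cancel (by simp) ENNReal.ofReal_ne_top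
      calc _ = 1 * ((ENNReal.ofReal Real.pi)⁻¹ * ENNReal.ofReal ρ * L *
            ENNReal.ofReal ((1 - ρ ^ 2) ^ β)) := by ring
        _ = _ := by rw [← h2]; ring
    · rw [Set.indicator_of_notMem (by simpa using h1)]
      have hFe : ∀ θ, F (circleMap 0 ρ θ) = 0 := fun θ =>
        Set.indicator_of_notMem (by rw [mem_ball_zero_iff, hn]; exact h1) _
      simp [hFe]
  rw [← lintegral_indicator Metric.isOpen_ball.measurableSet, ← hF,
    lintegral_eq_lintegral_circleMap hFm, ← lintegral_const_mul' _ _ (by simpa using hπ),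
    setLIntegral_congr_fun measurableSet_Ioi hcirc, setLIntegral_indicator measurableSet_Iio,
    Set.inter_comm, Set.Ioi_inter_Iio]

/-- The weight `x ^ β (x + δ) ^ (-β - 2)`, `x = 1 - ρ`, has integral at most `1 / ((β + 1) δ)`. -/
theorem lintegral_weight_le {β δ : ℝ} (hβ : -1 < β) (hδ : 0 < δ) :
    ∫⁻ ρ in Set.Ioo (0 : ℝ) 1, ENNReal.ofReal ((1 - ρ) ^ β * (1 - ρ + δ) ^ (-β - 2)) ≤
      ENNReal.ofReal (1 / ((β + 1) * δ)) := by
  have hβ' : 0 < β + 1 := by linarith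
  -- An explicit primitive: with `x = 1 - ρ`, the derivative of `x / (x + δ)` in `x` is `δ / (x + δ)
  -- ^ 2`.
  set g : ℝ → ℝ := fun ρ => -(((1 - ρ) / (1 - ρ + δ)) ^ (β + 1) / ((β + 1) * δ)) with hg
  set g' : ℝ → ℝ := fun ρ => (1 - ρ) ^ β * (1 - ρ + δ) ^ (-β - 2) with hg'
  have hcont : ContinuousOn g (Set.Icc 0 1) := by
    refine ContinuousOn.neg (ContinuousOn.div_const (ContinuousOn.rpow_const ?_ ?_) _)
    · refine ContinuousOn.div (by fun_prop) (by fun_prop) fun x hx => ?_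
      have := hx.2
      linarith
    · exact fun x hx => Or.inr hβ'.le
  have hpos : ∀ x ∈ Set.Ioo (0 : ℝ) 1, 0 ≤ g' x := by
    intro x hx
    have h1 : 0 < 1 - x := by linarith [hx.2]
    positivity
  have hderiv : ∀ x ∈ Set.Ioo (0 : ℝ) 1, HasDerivAt g (g' x) x := by
    intro x hx
    have h1 : 0 < 1 - x := by linarith [hx.2]
    have h2 : 0 < 1 - x + δ := by linarith
    have d1 : HasDerivAt (fun ρ : ℝ => 1 - ρ) (-1) x := by
      simpa using (hasDerivAt_id x).const_sub 1
    have d2 : HasDerivAt (fun ρ : ℝ => 1 - ρ + δ) (-1) x := d1.add_const δ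
    have d3 := d1.div d2 h2.ne'
    have hq : (1 - x) / (1 - x + δ) ≠ 0 := (div_pos h1 h2).ne'
    have d4 := ((d3.rpow_const (p := β + 1) (Or.inl hq)).div_const ((β + 1) * δ)).neg
    refine HasDerivAt.congr_deriv (f := g) d4 ?_
    simp only [hg', Pi.div_apply]
    rw [add_sub_cancel_right, Real.div_rpow h1.le h2.le,
      show -β - 2 = -β + -2 by ring, Real.rpow_add h2, Real.rpow_neg h2.le, Real.rpow_neg h2.le,
      Real.rpow_two]
    have := Real.rpow_pos_of_pos h2 β
    field_simp
    ring
  -- For `β < 0` the weight may blow up at `ρ = 1`; integrability follows from its sign and the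
  -- continuity of the primitive up to the endpoint.
  have hint : IntegrableOn g' (Set.Ioc 0 1) :=
    intervalIntegral.integrableOn_deriv_of_nonneg hcont hderiv hpos
  have hFTC := intervalIntegral.integral_eq_sub_of_hasDerivAt_of_le zero_le_one hcont hderiv
    ((intervalIntegrable_iff_integrableOn_Ioc_of_le zero_le_one).mpr hint)
  rw [← ofReal_integral_eq_lintegral_ofReal (hint.mono_set Set.Ioo_subset_Ioc_self)
    ((ae_restrict_iff' measurableSet_Ioo).mpr (Filter.Eventually.of_forall hpos)),
    ← integral_Ioc_eq_integral_Ioo, ← intervalIntegral.integral_of_le zero_le_one, hFTC]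
  apply ENNReal.ofReal_le_ofReal
  have h1 : g 1 = 0 := by simp [hg, Real.zero_rpow hβ'.ne']
  have h0 : ((1 - 0) / (1 - 0 + δ)) ^ (β + 1) ≤ 1 := by
    apply Real.rpow_le_one (by positivity) _ hβ'.le
    rw [div_le_one (by positivity)]
    linarith
  rw [h1, hg, zero_sub, neg_neg]
  gcongr

theorem rpow_le_of_le_of_le {x d L : ℝ} (hd : 0 < d) (hL : 1 ≤ L) (h1 : d ≤ x) (h2 : x ≤ L * d)
    (β : ℝ) : x ^ β ≤ L ^ |β| * d ^ β := by
  have hx : 0 < x := by linarith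
  rcases le_total 0 β with hβ | hβ
  · rw [abs_of_nonneg hβ, ← Real.mul_rpow (by linarith) hd.le]
    exact Real.rpow_le_rpow hx.le h2 hβ
  · calc x ^ β ≤ d ^ β := Real.rpow_le_rpow_of_nonpos hd h1 hβ
      _ ≤ _ := le_mul_of_one_le_left (by positivity) (Real.one_le_rpow hL (abs_nonneg β))

theorem bergmanNorm_pointwise {p β : ℝ} (hp : 1 ≤ p) {f : ℂ → ℂ}
    (hf : f ∈ unitBall (bergmanNorm p β)) {w : ℂ} (hw : w ∈ disc) :
    ‖f w‖ ≤ (16 * 4 ^ |β|) ^ (1 / p) * (1 - ‖w‖) ^ (-((2 + β) / p)) := by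
  have hw1 : ‖w‖ < 1 := by simpa using hw
  set d := 1 - ‖w‖ with hd'
  have hd : 0 < d := by linarith
  have hd1 : d ≤ 1 := by linarith [norm_nonneg w]
  have hp0 : 0 < p := by linarith
  have hm : ∫⁻ ρ in Set.Ioo (0 : ℝ) 1,
      ENNReal.ofReal (2 * ρ * (1 - ρ ^ 2) ^ β) * meanPow p f ρ ≤ 1 := by
    have h2 := ENNReal.rpow_le_rpow hf.2 hp0.le
    rwa [bergmanNorm_eq hp0 hf.1.continuousOn, ← ENNReal.rpow_mul, one_div_mul_cancel hp0.ne',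
      ENNReal.rpow_one, ENNReal.one_rpow] at h2
  -- On this annulus `R - |w| ≥ d / 2`, `2 R ≥ 1` and `d / 4 ≤ 1 - R ^ 2 ≤ d`, so the circle
  -- estimate is uniform; its width `d / 4` supplies the last factor `d`.
  have hpt : ∀ R ∈ Set.Ioo (1 - d / 2) (1 - d / 4),
      ENNReal.ofReal (d ^ β / 4 ^ |β| * (d / 4) * ‖f w‖ ^ p) ≤
        ENNReal.ofReal (2 * R * (1 - R ^ 2) ^ β) * meanPow p f R := by
    intro R hR
    have hR1 := hR.1
    have hR2 := hR.2
    have h := enorm_rpow_le_meanPow hp hf.1 (w := w) (R := R) (by linarith) (by linarith)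
    have hRw : d / 2 ≤ R - ‖w‖ := by linarith
    have h' : ENNReal.ofReal (‖f w‖ ^ p) ≤ ENNReal.ofReal (4 / d) * meanPow p f R := by
      rw [← ENNReal.ofReal_rpow_of_nonneg (norm_nonneg _) hp0.le, ofReal_norm]
      refine h.trans (mul_le_mul' (ENNReal.ofReal_le_ofReal ?_) le_rfl)
      calc 2 / (R - ‖w‖) ≤ 2 / (d / 2) := by gcongr
        _ = 4 / d := by field_simp; norm_num
    have hwt : d ^ β / 4 ^ |β| ≤ 2 * R * (1 - R ^ 2) ^ β := by
      have hx : 0 < 1 - R ^ 2 := by nlinarith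
      have hA : d ^ β / 4 ^ |β| ≤ (1 - R ^ 2) ^ β := by
        rw [div_le_iff₀ (by positivity)]
        rcases le_total 0 β with hβ | hβ
        · rw [abs_of_nonneg hβ, ← Real.mul_rpow hx.le (by norm_num)]
          exact Real.rpow_le_rpow hd.le (by nlinarith) hβ
        · refine (Real.rpow_le_rpow_of_nonpos hx (by nlinarith) hβ).trans ?_
          exact le_mul_of_one_le_right (by positivity)
            (Real.one_le_rpow (by norm_num) (abs_nonneg β))
      refine hA.trans ?_
      exact le_mul_of_one_le_left (by positivity) (by linarith)
    rw [mul_assoc, ENNReal.ofReal_mul (by positivity)]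
    refine mul_le_mul' (ENNReal.ofReal_le_ofReal hwt) ?_
    rw [ENNReal.ofReal_mul (by positivity)]
    calc _ ≤ ENNReal.ofReal (d / 4) * (ENNReal.ofReal (4 / d) * meanPow p f R) := by gcongr
      _ = _ := by
        rw [← mul_assoc, ← ENNReal.ofReal_mul (by positivity),
          show d / 4 * (4 / d) = 1 by field_simp, ENNReal.ofReal_one, one_mul]
  have hint : ENNReal.ofReal (d ^ β / 4 ^ |β| * (d / 4) * ‖f w‖ ^ p) * ENNReal.ofReal (d / 4) ≤ 1 := by
    refine le_trans ?_ hm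
    calc _ = ∫⁻ _ in Set.Ioo (1 - d / 2) (1 - d / 4),
          ENNReal.ofReal (d ^ β / 4 ^ |β| * (d / 4) * ‖f w‖ ^ p) := by
          rw [setLIntegral_const, Real.volume_Ioo]
          congr 2
          ring
      _ ≤ ∫⁻ R in Set.Ioo (1 - d / 2) (1 - d / 4),
          ENNReal.ofReal (2 * R * (1 - R ^ 2) ^ β) * meanPow p f R :=
          setLIntegral_mono' measurableSet_Ioo hpt
      _ ≤ _ := lintegral_mono_set (Set.Ioo_subset_Ioo (by linarith) (by linarith))
  rw [← ENNReal.ofReal_mul (by positivity), ENNReal.ofReal_le_one] at hint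
  have h' : ‖f w‖ ^ p ≤ 16 * 4 ^ |β| * d ^ (-(2 + β)) := by
    rw [Real.rpow_neg hd.le, Real.rpow_add hd, Real.rpow_two, ← div_eq_mul_inv,
      le_div_iff₀ (by positivity)]
    have h4 : 0 < (4 : ℝ) ^ |β| := by positivity
    have e : ‖f w‖ ^ p * (d ^ 2 * d ^ β) =
        16 * 4 ^ |β| * (d ^ β / 4 ^ |β| * (d / 4) * ‖f w‖ ^ p * (d / 4)) := by
      field_simp
      norm_num
    rw [e]
    exact mul_le_of_le_one_right (by positivity) hint
  have := Real.rpow_le_rpow (by positivity) h' (by positivity : 0 ≤ 1 / p)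
  rwa [← Real.rpow_mul (norm_nonneg _), mul_one_div_cancel hp0.ne', Real.rpow_one,
    Real.mul_rpow (by positivity) (by positivity), ← Real.rpow_mul hd.le,
    show -(2 + β) * (1 / p) = -((2 + β) / p) by ring] at this

theorem testFun_mem_unitBall_bergmanNorm {p β : ℝ} (hp : 1 ≤ p) (hβ : -1 < β) {k : ℕ}
    (hk : 2 ≤ k) (hkβ : β + 3 ≤ k) {ζ : ℂ} (hζ : ζ ∈ disc) :
    testFun ((2 ^ (|β| + k * p) / (β + 1)) ^ (-(1 / p))) ((2 + β) / p) k ζ ∈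
      unitBall (bergmanNorm p β) := by
  have hζ1 : ‖ζ‖ < 1 := by simpa using hζ
  have hp0 : 0 < p := by linarith
  have hβ' : 0 < β + 1 := by linarith
  have hkp : β + 3 ≤ k * p := by nlinarith
  set K : ℝ := 2 ^ (|β| + k * p) / (β + 1) with hK
  have hK0 : 0 < K := by positivity
  set δ := 1 - ‖ζ‖ with hδ'
  have hδ : 0 < δ := by linarith
  have hδ1 : δ ≤ 1 := by linarith [norm_nonneg ζ]
  refine ⟨differentiableOn_testFun _ _ _ hζ1, ?_⟩
  rw [bergmanNorm_eq hp0 (differentiableOn_testFun _ _ _ hζ1).continuousOn]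
  suffices h : ∫⁻ ρ in Set.Ioo (0 : ℝ) 1, ENNReal.ofReal (2 * ρ * (1 - ρ ^ 2) ^ β) *
      meanPow p (testFun (K ^ (-(1 / p))) ((2 + β) / p) k ζ) ρ ≤ 1 by
    have h2 := ENNReal.rpow_le_rpow h (by positivity : 0 ≤ 1 / p)
    rwa [ENNReal.one_rpow] at h2
  have hcp : (K ^ (-(1 / p))) ^ p = K⁻¹ := by
    rw [← Real.rpow_mul hK0.le, show -(1 / p) * p = -1 by field_simp, Real.rpow_neg_one]
  have hpt : ∀ ρ ∈ Set.Ioo (0 : ℝ) 1, ENNReal.ofReal (2 * ρ * (1 - ρ ^ 2) ^ β) *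
      meanPow p (testFun (K ^ (-(1 / p))) ((2 + β) / p) k ζ) ρ ≤
      ENNReal.ofReal ((β + 1) * δ) *
        ENNReal.ofReal ((1 - ρ) ^ β * (1 - ρ + δ) ^ (-β - 2)) := by
    intro ρ hρ
    have hρ0 := hρ.1
    have hρ1 := hρ.2
    have hx : 0 < 1 - ρ := by linarith
    have hx2 : 0 < 1 - ρ ^ 2 := by nlinarith
    have hq : 0 < 1 - ‖ζ‖ * ρ := by nlinarith [norm_nonneg ζ]
    have h := meanPow_testFun_le (s := (2 + β) / p) (Real.rpow_pos_of_pos hK0 (-(1 / p))) hp hk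
      hζ1 hρ0.le hρ1
    rw [hcp, div_mul_cancel₀ _ hp0.ne', ← hδ'] at h
    refine (mul_le_mul' le_rfl h).trans ?_
    rw [← ENNReal.ofReal_mul (by positivity), ← ENNReal.ofReal_mul (by positivity)]
    apply ENNReal.ofReal_le_ofReal
    have b1 : 2 * ρ * (1 - ρ ^ 2) ^ β ≤ 2 * (2 ^ |β| * (1 - ρ) ^ β) := by
      have : (1 - ρ ^ 2) ^ β ≤ 2 ^ |β| * (1 - ρ) ^ β :=
        rpow_le_of_le_of_le hx (by norm_num) (by nlinarith) (by nlinarith) β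
      have h0 : 0 < (1 - ρ ^ 2) ^ β := by positivity
      nlinarith
    -- Since `1 - |ζ| ρ` is at least both `1 - ρ` and `δ`, it is at least their mean. The surplus
    -- exponent `k * p - 3 - β`, nonnegative by the choice of `k`, is spent on `δ`, leaving the
    -- weight with explicit primitive.
    have b2 : (1 - ‖ζ‖ * ρ) ^ (1 - k * p) ≤
        2 ^ (k * p - 1) * (δ ^ (-(k * p - 3 - β)) * (1 - ρ + δ) ^ (-β - 2)) := by
      have h1 : (1 - ρ + δ) / 2 ≤ 1 - ‖ζ‖ * ρ := by
        have : ‖ζ‖ = 1 - δ := by rw [hδ']; ring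
        rw [this]
        nlinarith
      calc (1 - ‖ζ‖ * ρ) ^ (1 - k * p) ≤ ((1 - ρ + δ) / 2) ^ (1 - k * p) :=
            Real.rpow_le_rpow_of_nonpos (by positivity) h1 (by linarith)
        _ = 2 ^ (k * p - 1) * (1 - ρ + δ) ^ (1 - k * p) := by
            rw [Real.div_rpow (by positivity) (by norm_num), div_eq_mul_inv,
              ← Real.rpow_neg (by norm_num), neg_sub, mul_comm]
        _ = 2 ^ (k * p - 1) * ((1 - ρ + δ) ^ (-(k * p - 3 - β)) * (1 - ρ + δ) ^ (-β - 2)) := by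
            rw [← Real.rpow_add (by positivity)]
            congr 2
            ring
        _ ≤ _ := by
            gcongr ?_ * (?_ * _)
            exact Real.rpow_le_rpow_of_nonpos hδ (by linarith) (by linarith)
    calc 2 * ρ * (1 - ρ ^ 2) ^ β * (K⁻¹ * δ ^ (k * p - (2 + β)) * (1 - ‖ζ‖ * ρ) ^ (1 - k * p))
        ≤ 2 * (2 ^ |β| * (1 - ρ) ^ β) * (K⁻¹ * δ ^ (k * p - (2 + β)) *
          (2 ^ (k * p - 1) * (δ ^ (-(k * p - 3 - β)) * (1 - ρ + δ) ^ (-β - 2)))) := by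
          gcongr
      _ = (2 ^ (1 : ℝ) * 2 ^ |β| * 2 ^ (k * p - 1)) * K⁻¹ *
          (δ ^ (k * p - (2 + β)) * δ ^ (-(k * p - 3 - β))) *
          ((1 - ρ) ^ β * (1 - ρ + δ) ^ (-β - 2)) := by rw [Real.rpow_one]; ring
      _ = _ := by
          rw [← Real.rpow_add hδ, ← Real.rpow_add (by norm_num), ← Real.rpow_add (by norm_num),
            show k * p - (2 + β) + -(k * p - 3 - β) = 1 by ring,
            show 1 + |β| + (k * p - 1) = |β| + k * p by ring, Real.rpow_one, hK]
          have : (2 : ℝ) ^ (|β| + k * p) ≠ 0 := by positivity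
          field_simp
  calc _ ≤ ∫⁻ ρ in Set.Ioo (0 : ℝ) 1, ENNReal.ofReal ((β + 1) * δ) *
        ENNReal.ofReal ((1 - ρ) ^ β * (1 - ρ + δ) ^ (-β - 2)) :=
        setLIntegral_mono' measurableSet_Ioo hpt
    _ ≤ ENNReal.ofReal ((β + 1) * δ) * ENNReal.ofReal (1 / ((β + 1) * δ)) := by
        rw [lintegral_const_mul' _ _ ENNReal.ofReal_ne_top]
        gcongr
        exact lintegral_weight_le hβ hδ
    _ = 1 := by
        rw [← ENNReal.ofReal_mul (by positivity), mul_one_div_cancel (by positivity),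
          ENNReal.ofReal_one]

end DiscInterp

end

theorem theorem2p1 (p : ℝ) (hp : 1 ≤ p) :
    (∃ a b : ℝ, 0 < a ∧ 0 < b ∧ ∀ (n : ℕ) (r : ℝ), 1 ≤ n → 0 ≤ r → r < 1 →
      ENNReal.ofReal (a * ((n : ℝ) / (1 - r)) ^ (1 / p)) ≤
        DiscInterp.worstInterpConst (DiscInterp.hardyNorm p) n r ∧
      DiscInterp.worstInterpConst (DiscInterp.hardyNorm p) n r ≤
        ENNReal.ofReal (b * ((n : ℝ) / (1 - r)) ^ (1 / p)) ∧
      ∀ z : ℂ, ‖z‖ = r →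
        ENNReal.ofReal (a * ((n : ℝ) / (1 - r)) ^ (1 / p)) ≤
          DiscInterp.interpConst (DiscInterp.hardyNorm p) (fun _ : Fin n => z)) ∧
    ∀ β : ℝ, -1 < β →
      ∃ a b : ℝ, 0 < a ∧ 0 < b ∧ ∀ (n : ℕ) (r : ℝ), 1 ≤ n → 0 ≤ r → r < 1 →
        ENNReal.ofReal (a * ((n : ℝ) / (1 - r)) ^ ((2 + β) / p)) ≤
          DiscInterp.worstInterpConst (DiscInterp.bergmanNorm p β) n r ∧
        DiscInterp.worstInterpConst (DiscInterp.bergmanNorm p β) n r ≤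
          ENNReal.ofReal (b * ((n : ℝ) / (1 - r)) ^ ((2 + β) / p)) ∧
        (∀ z : ℂ, ‖z‖ = r →
          ENNReal.ofReal (a * ((n : ℝ) / (1 - r)) ^ ((2 + β) / p)) ≤
            DiscInterp.interpConst (DiscInterp.bergmanNorm p β) (fun _ : Fin n => z)) ∧
        ENNReal.ofReal a *
            DiscInterp.evalNorm (DiscInterp.bergmanNorm p β) ((1 - (1 - r) / (n : ℝ) : ℝ) : ℂ) ≤
          DiscInterp.worstInterpConst (DiscInterp.bergmanNorm p β) n r ∧
        DiscInterp.worstInterpConst (DiscInterp.bergmanNorm p β) n r ≤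
          ENNReal.ofReal b *
            DiscInterp.evalNorm (DiscInterp.bergmanNorm p β)
              ((1 - (1 - r) / (n : ℝ) : ℝ) : ℂ) := by
  have hp0 : 0 < p := by linarith
  refine ⟨?_, fun β hβ => ?_⟩
  · obtain ⟨a, b, ha, hb, h⟩ := DiscInterp.interpConst_estimates (s := 1 / p) (by positivity)
      one_pos (by positivity) one_le_two
      (fun f hf w hw => DiscInterp.hardyNorm_pointwise hp hf hw)
      (fun ζ hζ => DiscInterp.testFun_mem_unitBall_hardyNorm hp hζ)
    refine ⟨a, b, ha, hb, fun n r hn hr0 hr1 => ?_⟩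
    obtain ⟨h1, h2, h3, -⟩ := h n r hn hr0 hr1
    exact ⟨h1, h2, h3⟩
  -- The kernel power must grow with `β` for the surplus exponent to be nonnegative; for Hardy
  -- spaces the power `2` suffices.
  · obtain ⟨m, hm⟩ := exists_nat_ge (β + 3)
    have hm2 : 2 ≤ m := by
      have : (2 : ℝ) ≤ m := by linarith
      exact_mod_cast this
    have hβ' : 0 < β + 1 := by linarith
    have hβ2 : 0 < 2 + β := by linarith
    exact DiscInterp.interpConst_estimates (s := (2 + β) / p) (by positivity)
      (by positivity) (by positivity) (by omega)
      (fun f hf w hw => DiscInterp.bergmanNorm_pointwise hp hf hw)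
      (fun ζ hζ => DiscInterp.testFun_mem_unitBall_bergmanNorm hp hβ hm2 hm hζ)
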